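/- Let $n\ge 1$ and let $V:\mathbb R^n\to\mathbb R^n$ be smooth, $\mathbb Z^n$-periodic, with $\operatorname{div}V=0$ and $\int_{\mathbb T^n}V\,dx=0$, where $\mathbb T^n=\mathbb R^n/\mathbb Z^n$, and let $v_k=\int_{\mathbb T^n}V(x)e^{-2\pi i k\cdot x}\,dx\in\mathbb C^n$ for $k\in\mathbb Z^n$. For every $\varepsilon\in\mathbb R$ and $q\in\mathbb R^n$ there is a unique constant $\overline H_\varepsilon(q)\in\mathbb R$ such that the cell problem $$|q+Du|^2+\varepsilon V(x)\cdot(q+Du)=\overline H_\varepsilon(q)\quad\text{in }\mathbb T^n$$ has a Lipschitz continuous $\mathbb Z^n$-periodic viscosity solution $u$. Put $$\alpha_\varepsilon(q)=\inf_{\lambda>0}\frac{1+\overline H_\varepsilon(\lambda q)}{\lambda}.$$ Let $p\in\mathbb R^n$ satisfy a Diophantine condition: there are $c>0$ and $\gamma>0$ with $|p\cdot k|\ge c/|k|^{\gamma}$ for all $k\in\mathbb Z^n\setminus\{0\}$. Then the series $$a_2(p)=\frac14\sum_{k\in\mathbb Z^n\setminus\{0\}}\frac{|p\cdot v_k|^2|k|^2}{|p\cdot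 k|^2}$$ converges, and $$\lim_{\varepsilon\to0}\frac{\alpha_\varepsilon(p)-2|p|}{\varepsilon^2|p|}=a_2(p).$$ -/

import Mathlib

open Filter Topology MeasureTheory
open scoped ContDiff

noncomputable section

namespace FlameSpeed

/-- The integer vector `k`, as a point of Euclidean space. -/
def intVec {n : ℕ} (k : Fin n → ℤ) : EuclideanSpace ℝ (Fin n) :=
  WithLp.toLp 2 (fun i => (k i : ℝ))

/-- A function on the flat torus `ℝⁿ/ℤⁿ`, seen as a `ℤⁿ`-periodic function on `ℝⁿ`. -/
def IsPeriodic {n : ℕ} {β : Type*} (f : EuclideanSpace ℝ (Fin n) → β) : Prop :=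
  ∀ (x : EuclideanSpace ℝ (Fin n)) (k : Fin n → ℤ), f (x + intVec k) = f x

/-- The fundamental domain `[0,1)ⁿ` of the torus. -/
def unitCube (n : ℕ) : Set (EuclideanSpace ℝ (Fin n)) :=
  {x | ∀ i, x i ∈ Set.Ico (0 : ℝ) 1}

/-- Smooth, `ℤⁿ`-periodic, incompressible velocity fields with mean zero. -/
structure IsFlow {n : ℕ} (V : EuclideanSpace ℝ (Fin n) → EuclideanSpace ℝ (Fin n)) : Prop where
  smooth : ContDiff ℝ ∞ V
  periodic : IsPeriodic V
  div_eq_zero : ∀ x, ∑ i, (fderiv ℝ V x (EuclideanSpace.single i 1)) i = 0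
  mean_eq_zero : ∫ x in unitCube n, V x = 0

/-- The Hamiltonian `H(q, x) = |q|² + V(x) · q`. -/
def hamiltonian {n : ℕ} (V : EuclideanSpace ℝ (Fin n) → EuclideanSpace ℝ (Fin n))
    (q x : EuclideanSpace ℝ (Fin n)) : ℝ :=
  ‖q‖ ^ 2 + inner ℝ (V x) q

/-- `u` is a viscosity subsolution of `F(Du, x) = c` on `ℝⁿ`, with `C¹` test functions. -/
def IsViscositySubsolution {n : ℕ}
    (F : EuclideanSpace ℝ (Fin n) → EuclideanSpace ℝ (Fin n) → ℝ) (c : ℝ)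
    (u : EuclideanSpace ℝ (Fin n) → ℝ) : Prop :=
  ∀ φ : EuclideanSpace ℝ (Fin n) → ℝ, ContDiff ℝ 1 φ →
    ∀ x, IsLocalMax (fun y => u y - φ y) x → F (gradient φ x) x ≤ c

/-- `u` is a viscosity supersolution of `F(Du, x) = c` on `ℝⁿ`, with `C¹` test functions. -/
def IsViscositySupersolution {n : ℕ}
    (F : EuclideanSpace ℝ (Fin n) → EuclideanSpace ℝ (Fin n) → ℝ) (c : ℝ)
    (u : EuclideanSpace ℝ (Fin n) → ℝ) : Prop :=
  ∀ φ : EuclideanSpace ℝ (Fin n) → ℝ, ContDiff ℝ 1 φ →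
    ∀ x, IsLocalMin (fun y => u y - φ y) x → c ≤ F (gradient φ x) x

/-- `c` is an ergodic constant at `p`: the cell problem `|p + Du|² + V · (p + Du) = c` has a
periodic Lipschitz viscosity solution. -/
def IsErgodicConstant {n : ℕ} (V : EuclideanSpace ℝ (Fin n) → EuclideanSpace ℝ (Fin n))
    (p : EuclideanSpace ℝ (Fin n)) (c : ℝ) : Prop :=
  ∃ u : EuclideanSpace ℝ (Fin n) → ℝ, IsPeriodic u ∧ (∃ K, LipschitzWith K u) ∧
    IsViscositySubsolution (fun q x => hamiltonian V (p + q) x) c u ∧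
    IsViscositySupersolution (fun q x => hamiltonian V (p + q) x) c u

/-- The effective Hamiltonian: the ergodic constant at `p` (an arbitrary real number if there were
none). -/
def effectiveHamiltonian {n : ℕ} (V : EuclideanSpace ℝ (Fin n) → EuclideanSpace ℝ (Fin n))
    (p : EuclideanSpace ℝ (Fin n)) : ℝ :=
  Classical.epsilon (fun c => IsErgodicConstant V p c)

/-- The effective burning velocity `α(p) = inf_{l > 0} (1 + H̄(l p)) / l`. -/
def burningVelocity {n : ℕ} (V : EuclideanSpace ℝ (Fin n) → EuclideanSpace ℝ (Fin n))
    (p : EuclideanSpace ℝ (Fin n)) : ℝ :=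
  ⨅ l : Set.Ioi (0 : ℝ), (1 + effectiveHamiltonian V ((l : ℝ) • p)) / (l : ℝ)

/-- The Diophantine condition `|p · k| ≥ c / |k|^γ` for all nonzero integer vectors `k`. -/
def IsDiophantine {n : ℕ} (p : EuclideanSpace ℝ (Fin n)) : Prop :=
  ∃ c > (0 : ℝ), ∃ γ > (0 : ℝ), ∀ k : Fin n → ℤ, k ≠ 0 →
    c / ‖intVec k‖ ^ γ ≤ |inner ℝ p (intVec k)|

/-- The Fourier coefficient `v_k = ∫ V(x) e^{-2πi k·x} dx ∈ ℂⁿ` over the torus. -/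
def fourierCoeffVec {n : ℕ} (V : EuclideanSpace ℝ (Fin n) → EuclideanSpace ℝ (Fin n))
    (k : Fin n → ℤ) (j : Fin n) : ℂ :=
  ∫ x in unitCube n,
    Complex.exp (-(2 * Real.pi * Complex.I * (inner ℝ (intVec k) x : ℝ))) * ((V x j : ℝ) : ℂ)

/-- The term `|p · v_k|² |k|² / |p · k|²`. -/
def secondOrderTerm {n : ℕ} (V : EuclideanSpace ℝ (Fin n) → EuclideanSpace ℝ (Fin n))
    (p : EuclideanSpace ℝ (Fin n)) (k : Fin n → ℤ) : ℝ :=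
  ‖∑ j, (p j : ℂ) * fourierCoeffVec V k j‖ ^ 2 * ‖intVec k‖ ^ 2 / |inner ℝ p (intVec k)| ^ 2

/-- `a₂(p) = ¼ ∑_{k ≠ 0} |p · v_k|² |k|² / |p · k|²`. -/
def secondOrderCoeff {n : ℕ} (V : EuclideanSpace ℝ (Fin n) → EuclideanSpace ℝ (Fin n))
    (p : EuclideanSpace ℝ (Fin n)) : ℝ :=
  1 / 4 * ∑' k : {k : Fin n → ℤ // k ≠ 0}, secondOrderTerm V p k

end FlameSpeed

end

/-! The effective Hamiltonian is computed to second order in `ε` by inserting an explicit corrector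
into the cell problem. A `C¹` periodic `w` is itself an admissible test function: where `w - u` is
maximal or minimal, the viscosity inequalities compare the ergodic constant with `H(q + Dw, x)`.
Hence any `w` making this expression nearly constant locates the ergodic constant with the same
error.

For `q = l p` take `w = ε w₁ + (ε²/l) w₂`. The terms of order `ε` cancel if `2 p · Dw₁ = -V · p`.
This is solved mode by mode: the Diophantine bound costs a power of `|k|`, absorbed by the rapid
decay of the coefficients of the smooth field (`exists_cohomological`). The terms of order `ε²`
become a constant `a` if `2 p · Dw₂ + |Dw₁|² + V · Dw₁ = a`, where `a` must be the mean of the last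
two terms. An approximate solution is enough here, and trigonometric polynomials supply it
(`exists_approx_cohomological`). So the ergodic constant is `l²|p|² + ε² a + o(ε²)`, uniformly for
`l` bounded away from `0` (`abs_effectiveHamiltonian_sub_le`). Since `V` is divergence free, `a = ∫
|Dw₁|²`, and Parseval identifies this with `a₂(p)` (`hasSum_secondOrderTerm`). Minimising `(1 + ε² a
+ l²|p|²) / l` over `l` gives `2|p| √(1 + ε² a)`, whence the limit (`tendsto_iInf_div`).

The ergodic constant must also be shown to exist and be unique. Existence is a vanishing-discount
argument: a discrete-time control problem is solved by contraction, its solutions are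
equi-Lipschitz, and they converge along an ultrafilter (`exists_isErgodicConstant`). Uniqueness is
comparison by doubling the variables (`le_of_sub_of_super`). -/

noncomputable section

namespace FlameSpeed

variable {n : ℕ}

/-! ### Discounted Bellman equation -/

/-- The discounted Bellman equation with bounded running cost has exactly one bounded solution. -/
theorem exists_unique_bellman {X W : Type*} [Nonempty W] (s : X → W → X) (l : X → W → ℝ)
    {b m M : ℝ} (hb0 : 0 ≤ b) (hb1 : b < 1) (hm : ∀ x w, m ≤ l x w)
    (hM : ∀ x, ∃ w, l x w ≤ M) :
    ∃ u : X → ℝ, (∃ C, ∀ x, |u x| ≤ C) ∧ (∀ x, u x = ⨅ w, (b * u (s x w) + l x w)) ∧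
      ∀ v : X → ℝ, (∃ C, ∀ x, |v x| ≤ C) → (∀ x, v x = ⨅ w, (b * v (s x w) + l x w)) → v = u := by
  have bdd : ∀ (u : X → ℝ) (C : ℝ), (∀ x, |u x| ≤ C) → ∀ x,
      BddBelow (Set.range fun w => b * u (s x w) + l x w) := by
    intro u C hC x
    refine ⟨b * (-C) + m, ?_⟩
    rintro _ ⟨w, rfl⟩
    have := (abs_le.1 (hC (s x w))).1
    have h2 := hm x w
    simp only
    gcongr
  have bound : ∀ (u : X → ℝ) (C : ℝ), (∀ x, |u x| ≤ C) → ∀ x,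
      |⨅ w, (b * u (s x w) + l x w)| ≤ b * C + max |m| |M| := by
    intro u C hC x
    rw [abs_le]
    constructor
    · refine le_ciInf fun w => ?_
      have := (abs_le.1 (hC (s x w))).1
      have h2 := hm x w
      have h3 := neg_abs_le m
      have h4 := le_max_left |m| |M|
      nlinarith
    · obtain ⟨w, hw⟩ := hM x
      refine (ciInf_le (bdd u C hC x) w).trans ?_
      have := (abs_le.1 (hC (s x w))).2
      have h3 := le_abs_self M
      have h4 := le_max_right |m| |M|
      nlinarith
  have contr : ∀ (u v : X → ℝ) (C D : ℝ), (∀ x, |u x| ≤ C) → (∀ x, |u x - v x| ≤ D) → ∀ x,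
      (⨅ w, (b * u (s x w) + l x w)) - (⨅ w, (b * v (s x w) + l x w)) ≤ b * D := by
    intro u v C D hu huv x
    rw [sub_le_iff_le_add, add_comm, ← sub_le_iff_le_add]
    refine le_ciInf fun w => ?_
    have h1 := ciInf_le (bdd u C hu x) w
    have h2 := (abs_le.1 (huv (s x w))).2
    nlinarith
  -- All bounded functions with the sup norm: complete, and stable under the Bellman operator with
  -- no regularity to check.
  let Y := lp (fun _ : X => ℝ) ⊤
  have hmem : ∀ u : X → ℝ, (∃ C, ∀ x, |u x| ≤ C) → Memℓp (E := fun _ : X => ℝ) u ⊤ := by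
    rintro u ⟨C, hC⟩
    refine memℓp_infty ⟨C, ?_⟩
    rintro _ ⟨x, rfl⟩
    exact hC x
  have hY : ∀ (u : Y) x, |u x| ≤ ‖u‖ := fun u x => lp.norm_apply_le_norm (by simp) u x
  let T : Y → Y := fun u => ⟨fun x => ⨅ w, (b * u (s x w) + l x w),
    hmem _ ⟨_, bound u ‖u‖ (hY u)⟩⟩
  have hT : ContractingWith ⟨b, hb0⟩ T := by
    refine ⟨hb1, LipschitzWith.of_dist_le_mul fun u v => ?_⟩
    rw [dist_eq_norm, dist_eq_norm]
    refine lp.norm_le_of_forall_le (by positivity) fun x => ?_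
    have huv : ∀ x, |u x - v x| ≤ ‖u - v‖ := fun x => hY (u - v) x
    have hvu : ∀ x, |v x - u x| ≤ ‖u - v‖ := fun x => by rw [abs_sub_comm]; exact huv x
    have h1 := contr u v _ _ (hY u) huv x
    have h2 := contr v u _ _ (hY v) hvu x
    exact abs_sub_le_iff.2 ⟨h1, h2⟩
  have : Nonempty Y := ⟨0⟩
  refine ⟨(ContractingWith.fixedPoint T hT : Y), ⟨_, hY _⟩, fun x => ?_, fun v hv hvT => ?_⟩
  · exact congrFun (congrArg Subtype.val hT.fixedPoint_isFixedPt.symm) x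
  · have : (⟨v, hmem v hv⟩ : Y) = ContractingWith.fixedPoint T hT := by
      refine hT.fixedPoint_unique ?_
      apply Subtype.ext
      funext x
      exact (hvT x).symm
    exact congrArg Subtype.val this

/-! ### Lagrangian and Fenchel duality -/

/-- The Lagrangian `L(x, w) = ¼ |w - V(x)|² - p · w`, convex dual to `q ↦ H(p + q, x)`. -/
def lagrangian (V : EuclideanSpace ℝ (Fin n) → EuclideanSpace ℝ (Fin n))
    (p x w : EuclideanSpace ℝ (Fin n)) : ℝ :=
  ‖w - V x‖ ^ 2 / 4 - inner ℝ p w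

/-- Completing the square: the defect in the Fenchel inequality is an exact square, which vanishes
at `w = V x + 2 (p + q)`. The next two results read off the inequality and its equality case. -/
theorem lagrangian_add_hamiltonian (V : EuclideanSpace ℝ (Fin n) → EuclideanSpace ℝ (Fin n))
    (p q x w : EuclideanSpace ℝ (Fin n)) :
    lagrangian V p x w + hamiltonian V (p + q) x - inner ℝ q w
      = ‖(1 / 2 : ℝ) • (w - V x) - (p + q)‖ ^ 2 := by
  rw [lagrangian, hamiltonian, norm_sub_sq_real ((1 / 2 : ℝ) • (w - V x)), norm_smul,
    inner_smul_left, inner_sub_left]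
  simp only [inner_add_right, real_inner_comm w p, real_inner_comm w q]
  simp
  ring

theorem inner_sub_hamiltonian_le_lagrangian
    (V : EuclideanSpace ℝ (Fin n) → EuclideanSpace ℝ (Fin n))
    (p q x w : EuclideanSpace ℝ (Fin n)) :
    inner ℝ q w - hamiltonian V (p + q) x ≤ lagrangian V p x w := by
  have := lagrangian_add_hamiltonian V p q x w
  nlinarith [sq_nonneg ‖(1 / 2 : ℝ) • (w - V x) - (p + q)‖]

theorem lagrangian_optimal (V : EuclideanSpace ℝ (Fin n) → EuclideanSpace ℝ (Fin n))
    (p q x : EuclideanSpace ℝ (Fin n)) :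
    inner ℝ q (V x + (2 : ℝ) • (p + q)) - lagrangian V p x (V x + (2 : ℝ) • (p + q))
      = hamiltonian V (p + q) x := by
  have := lagrangian_add_hamiltonian V p q x (V x + (2 : ℝ) • (p + q))
  rw [add_sub_cancel_left, smul_smul] at this
  rw [show (1 / 2 : ℝ) * 2 = 1 by norm_num, one_smul, sub_self, norm_zero] at this
  linarith

section Bounds

variable {V : EuclideanSpace ℝ (Fin n) → EuclideanSpace ℝ (Fin n)} {B : ℝ}

theorem lagrangian_lower (hB : ∀ x, ‖V x‖ ≤ B) (p x w : EuclideanSpace ℝ (Fin n)) :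
    ‖w‖ ^ 2 / 4 - (B / 2 + ‖p‖) * ‖w‖ ≤ lagrangian V p x w := by
  have h1 := real_inner_le_norm p w
  have h2 : ‖w‖ ^ 2 - 2 * (‖w‖ * ‖V x‖) ≤ ‖w - V x‖ ^ 2 := by
    rw [norm_sub_sq_real]
    nlinarith [real_inner_le_norm w (V x), sq_nonneg ‖V x‖]
  have h3 := mul_le_mul_of_nonneg_left (hB x) (norm_nonneg w)
  rw [lagrangian]
  nlinarith

theorem lagrangian_upper (hB : ∀ x, ‖V x‖ ≤ B) (p x w : EuclideanSpace ℝ (Fin n)) :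
    lagrangian V p x w ≤ (‖w‖ + B) ^ 2 / 4 + ‖p‖ * ‖w‖ := by
  have h1 := (abs_le.1 (abs_real_inner_le_norm p w)).1
  have h2 : ‖w - V x‖ ^ 2 ≤ (‖w‖ + B) ^ 2 := by
    gcongr
    exact (norm_sub_le _ _).trans (by gcongr; exact hB x)
  rw [lagrangian]
  linarith

theorem lagrangian_sub_le {A R : ℝ} (hB : ∀ x, ‖V x‖ ≤ B) (hA : ∀ x y, ‖V x - V y‖ ≤ A * ‖x - y‖)
    (p x y : EuclideanSpace ℝ (Fin n)) {w z : EuclideanSpace ℝ (Fin n)} (hw : ‖w‖ ≤ R)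
    (hz : ‖z‖ ≤ R) :
    lagrangian V p y z - lagrangian V p x w
      ≤ (R + B + ‖p‖) * (‖z - w‖ + A * ‖y - x‖) := by
  have hR : 0 ≤ R := (norm_nonneg _).trans hw
  have hB0 : 0 ≤ B := (norm_nonneg _).trans (hB x)
  have h1 : ‖(z - V y) - (w - V x)‖ ≤ ‖z - w‖ + A * ‖y - x‖ := by
    have : (z - V y) - (w - V x) = (z - w) - (V y - V x) := by abel
    rw [this]
    exact (norm_sub_le _ _).trans (by gcongr; exact hA y x)
  have h2 : ‖z - V y‖ ≤ R + B := (norm_sub_le _ _).trans (add_le_add hz (hB y))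
  have h3 : ‖w - V x‖ ≤ R + B := (norm_sub_le _ _).trans (add_le_add hw (hB x))
  have h4 : ‖z - V y‖ ≤ ‖w - V x‖ + (‖z - w‖ + A * ‖y - x‖) :=
    (norm_le_insert' _ _).trans (by gcongr)
  have h5 : -(‖p‖ * ‖z - w‖) ≤ inner ℝ p z - inner ℝ p w := by
    rw [← inner_sub_right]
    exact (abs_le.1 (abs_real_inner_le_norm p _)).1
  set D := ‖z - w‖ + A * ‖y - x‖ with hD
  have hD1 : ‖z - w‖ ≤ D := by
    have : 0 ≤ A * ‖y - x‖ := (norm_nonneg _).trans (hA y x)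
    linarith
  have hD0 : 0 ≤ D := (norm_nonneg _).trans hD1
  have h6 : ‖z - V y‖ ^ 2 - ‖w - V x‖ ^ 2 ≤ 2 * (R + B) * D := by
    have : ‖z - V y‖ ^ 2 - ‖w - V x‖ ^ 2 = (‖z - V y‖ - ‖w - V x‖) * (‖z - V y‖ + ‖w - V x‖) := by
      ring
    rw [this]
    nlinarith [norm_nonneg (z - V y), norm_nonneg (w - V x)]
  have h7 := mul_le_mul_of_nonneg_left hD1 (norm_nonneg p)
  rw [lagrangian, lagrangian]
  nlinarith [mul_nonneg (add_nonneg hR hB0) hD0]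

end Bounds

/-! ### Discrete control problem and equi-Lipschitz bounds -/

theorem sub_le_of_forall_step {F : Type*} [NormedAddCommGroup F] [NormedSpace ℝ F] {u : F → ℝ}
    {C h : ℝ} (hC : 0 ≤ C) (hh : 0 < h)
    (hstep : ∀ x w, ‖w‖ ≤ 1 → u x ≤ u (x - h • w) + C * h) (x y : F) :
    u x - u y ≤ C * (‖x - y‖ + h) := by
  -- Enough steps to join `x` to `y` at speed at most `1`. The extra one keeps `N` positive when `x`
  -- and `y` are close, and costs at most one `h` of additional time.
  set N : ℕ := ⌊‖x - y‖ / h⌋₊ + 1 with hN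
  have hN0 : (0 : ℝ) < N := by rw [hN]; positivity
  have hN1 : ‖x - y‖ ≤ h * N := by
    have := (Nat.lt_floor_add_one (‖x - y‖ / h)).le
    rw [div_le_iff₀ hh] at this
    rw [hN, mul_comm]
    exact_mod_cast this
  have hN2 : h * N ≤ ‖x - y‖ + h := by
    have := Nat.floor_le (show 0 ≤ ‖x - y‖ / h by positivity)
    rw [le_div_iff₀ hh] at this
    rw [hN]
    push_cast
    linarith
  set w : F := (h * N)⁻¹ • (x - y) with hw
  have hw1 : ‖w‖ ≤ 1 := by
    rw [hw, norm_smul, norm_inv, Real.norm_of_nonneg (by positivity), inv_mul_le_iff₀ (by positivity)]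
    simpa using hN1
  have key : ∀ j : ℕ, u x ≤ u (x - (j * h) • w) + C * (j * h) := by
    intro j
    induction j with
    | zero => simp
    | succ j ih =>
      have := hstep (x - (j * h) • w) w hw1
      have e : x - (j * h) • w - h • w = x - (((j + 1 : ℕ) : ℝ) * h) • w := by
        push_cast
        module
      rw [e] at this
      push_cast at this ⊢
      linarith
  have h1 := key N
  have e : x - (N * h) • w = y := by
    rw [hw, smul_smul, mul_comm (N : ℝ) h, mul_inv_cancel₀ (by positivity), one_smul]
    abel
  rw [e, mul_comm (N : ℝ) h] at h1
  have := mul_le_mul_of_nonneg_left hN2 hC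
  linarith

/-- Time step `h` and discount `1 - h ^ 2`, that is, discount rate `h` per unit time, so `h * u` is
the quantity that stays bounded. Periodicity comes from uniqueness, since an integer translate of
`u` solves the same equation. -/
theorem exists_discrete_solution {V : EuclideanSpace ℝ (Fin n) → EuclideanSpace ℝ (Fin n)}
    (hV : IsPeriodic V) {B : ℝ} (hB : ∀ x, ‖V x‖ ≤ B)
    (p : EuclideanSpace ℝ (Fin n)) {h : ℝ}
    (h0 : 0 < h) (h1 : h < 1) :
    ∃ u : EuclideanSpace ℝ (Fin n) → ℝ, IsPeriodic u ∧
      (∀ x, |h * u x| ≤ (B / 2 + ‖p‖) ^ 2 + B ^ 2 / 4) ∧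
      (∀ x w, u x ≤ (1 - h ^ 2) * u (x - h • w) + h * lagrangian V p x w) ∧
      ∀ x, ∀ η > 0, ∃ w, (1 - h ^ 2) * u (x - h • w) + h * lagrangian V p x w ≤ u x + η := by
  have hm : ∀ x w, -(B / 2 + ‖p‖) ^ 2 ≤ lagrangian V p x w := fun x w => by
    have := lagrangian_lower hB p x w
    nlinarith [sq_nonneg (‖w‖ / 2 - (B / 2 + ‖p‖))]
  have hM : ∀ x, lagrangian V p x 0 ≤ B ^ 2 / 4 := fun x => by
    have := lagrangian_upper hB p x 0
    simpa using this
  have hh : 0 < h ^ 2 := by positivity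
  have hh1 : h ^ 2 < 1 := by nlinarith
  obtain ⟨u, ⟨C, hC⟩, hu, huniq⟩ := exists_unique_bellman
    (fun (x : EuclideanSpace ℝ (Fin n)) (w : EuclideanSpace ℝ (Fin n)) => x - h • w)
    (fun x w => h * lagrangian V p x w) (b := 1 - h ^ 2) (m := h * (-(B / 2 + ‖p‖) ^ 2))
    (M := h * (B ^ 2 / 4)) (by linarith) (by linarith)
    (fun x w => by gcongr; exact hm x w) (fun x => ⟨0, by gcongr; exact hM x⟩)
  have hbdd : ∀ x, BddBelow (Set.range fun w =>
      (1 - h ^ 2) * u (x - h • w) + h * lagrangian V p x w) := by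
    intro x
    refine ⟨(1 - h ^ 2) * (-C) + h * (-(B / 2 + ‖p‖) ^ 2), ?_⟩
    rintro _ ⟨w, rfl⟩
    have h2 := (abs_le.1 (hC (x - h • w))).1
    have h3 := hm x w
    have h4 : 0 ≤ 1 - h ^ 2 := by linarith
    simp only
    gcongr
  have hle : ∀ x w, u x ≤ (1 - h ^ 2) * u (x - h • w) + h * lagrangian V p x w := fun x w => by
    conv_lhs => rw [hu x]
    exact ciInf_le (hbdd x) w
  refine ⟨u, ?_, ?_, hle, ?_⟩
  · intro x k
    refine congrFun (huniq (fun x => u (x + intVec k)) ⟨C, fun x => hC _⟩ fun x => ?_) x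
    rw [hu]
    refine iInf_congr fun w => ?_
    have e1 : x + intVec k - h • w = x - h • w + intVec k := by abel
    have e2 : lagrangian V p (x + intVec k) w = lagrangian V p x w := by
      rw [lagrangian, lagrangian, hV]
    simp only [e1, e2]
  · intro x
    have hub : BddBelow (Set.range u) := ⟨-C, by rintro _ ⟨y, rfl⟩; exact (abs_le.1 (hC y)).1⟩
    have hI : (1 - h ^ 2) * (⨅ y, u y) + h * (-(B / 2 + ‖p‖) ^ 2) ≤ ⨅ y, u y := by
      refine le_ciInf fun y => ?_
      rw [hu y]
      refine le_ciInf fun w => ?_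
      have h2 := ciInf_le hub (y - h • w)
      have h3 := hm y w
      have h4 : 0 ≤ 1 - h ^ 2 := by linarith
      gcongr
    have hx : (⨅ y, u y) ≤ u x := ciInf_le hub x
    have h5 := hle x 0
    have h6 := hM x
    simp only [smul_zero, sub_zero] at h5
    have h7 : h * (-(B / 2 + ‖p‖) ^ 2) ≤ h * (h * u x) := by
      nlinarith [mul_le_mul_of_nonneg_left hx hh.le]
    have h8 : h * (h * u x) ≤ h * (B ^ 2 / 4) := by
      nlinarith
    have h9 := le_of_mul_le_mul_left h7 h0
    have h10 := le_of_mul_le_mul_left h8 h0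
    rw [abs_le]
    constructor <;> nlinarith [sq_nonneg B, sq_nonneg (B / 2 + ‖p‖)]
  · intro x η hη
    by_contra! hcon
    have : u x + η ≤ u x := by
      conv_rhs => rw [hu x]
      exact le_ciInf fun w => (hcon w).le
    linarith

/-- Moving at unit speed has bounded running cost, which gives a Lipschitz bound at scales above
`h`. With the superlinear growth of the Lagrangian, this bounds the near-optimal velocities by `R`
independently of `h`. At scales below `h`, a perturbed velocity steers `y` to the point reached from
`x`. -/
theorem exists_equiLipschitz_discrete_solution
    {V : EuclideanSpace ℝ (Fin n) → EuclideanSpace ℝ (Fin n)}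
    (hV : IsPeriodic V) {A B : ℝ} (hA0 : 0 ≤ A) (hB : ∀ x, ‖V x‖ ≤ B)
    (hA : ∀ x y, ‖V x - V y‖ ≤ A * ‖x - y‖) (p : EuclideanSpace ℝ (Fin n)) :
    ∃ K M R : ℝ, ∀ h, 0 < h → h < 1 → ∃ u : EuclideanSpace ℝ (Fin n) → ℝ, IsPeriodic u ∧
      (∀ x, |h * u x| ≤ M) ∧ (∀ x y, |u x - u y| ≤ K * ‖x - y‖) ∧
      (∀ x w, u x ≤ (1 - h ^ 2) * u (x - h • w) + h * lagrangian V p x w) ∧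
      ∀ x, ∃ w, ‖w‖ ≤ R ∧
        (1 - h ^ 2) * u (x - h • w) + h * lagrangian V p x w ≤ u x + h ^ 2 := by
  have hB0 : 0 ≤ B := (norm_nonneg _).trans (hB 0)
  have hp0 := norm_nonneg p
  obtain ⟨M, hM⟩ : ∃ M, M = (B / 2 + ‖p‖) ^ 2 + B ^ 2 / 4 := ⟨_, rfl⟩
  have hM0 : 0 ≤ M := by rw [hM]; positivity
  obtain ⟨C, hC⟩ : ∃ C, C = M + (1 + B) ^ 2 / 4 + ‖p‖ := ⟨_, rfl⟩
  have hC0 : 0 ≤ C := by rw [hC]; positivity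
  obtain ⟨R, hR⟩ : ∃ R, R = 4 * (B / 2 + ‖p‖ + 2 * C + M + 1) + 1 := ⟨_, rfl⟩
  obtain ⟨K, hK⟩ : ∃ K, K = 2 * C + (R + 1 + B + ‖p‖) * (1 + A) := ⟨_, rfl⟩
  have hR0 : 0 ≤ R := by rw [hR]; positivity
  refine ⟨K, M, R, fun h h0 h1 => ?_⟩
  obtain ⟨u, hper, hbd, hle, happ⟩ := exists_discrete_solution hV hB p h0 h1
  rw [← hM] at hbd
  have hstep : ∀ x w : EuclideanSpace ℝ (Fin n), ‖w‖ ≤ 1 → u x ≤ u (x - h • w) + C * h := by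
    intro x w hw
    have h2 := hle x w
    have h3 := (abs_le.1 (hbd (x - h • w))).1
    have h4 : lagrangian V p x w ≤ (1 + B) ^ 2 / 4 + ‖p‖ := by
      refine (lagrangian_upper hB p x w).trans ?_
      have : ‖p‖ * ‖w‖ ≤ ‖p‖ := mul_le_of_le_one_right hp0 hw
      gcongr
    have h5 := mul_le_mul_of_nonneg_left h4 h0.le
    have h6 := mul_le_mul_of_nonneg_left h3 h0.le
    rw [hC]
    nlinarith
  have hscale := sub_le_of_forall_step hC0 h0 hstep
  have hbound : ∀ x w : EuclideanSpace ℝ (Fin n), ∀ η ≤ h,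
      (1 - h ^ 2) * u (x - h • w) + h * lagrangian V p x w ≤ u x + η → ‖w‖ ≤ R := by
    intro x w η hη hw
    have h2 := hscale x (x - h • w)
    rw [sub_sub_cancel, norm_smul, Real.norm_of_nonneg h0.le] at h2
    have h3 := (abs_le.1 (hbd (x - h • w))).2
    have h4 : h * lagrangian V p x w ≤ h * (C * (‖w‖ + 1) + M + 1) := by
      have := mul_le_mul_of_nonneg_left h3 h0.le
      nlinarith
    have h5 := le_of_mul_le_mul_left h4 h0
    have h6 := lagrangian_lower hB p x w
    by_contra! hcon
    have h7 : 1 ≤ ‖w‖ := le_trans (by rw [hR]; nlinarith) hcon.le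
    have h8 : ‖w‖ * R ≤ ‖w‖ * ‖w‖ := mul_le_mul_of_nonneg_left hcon.le (norm_nonneg _)
    rw [hR] at h8
    nlinarith
  have hlip : ∀ x y, u y - u x ≤ K * ‖x - y‖ := by
    intro x y
    rcases le_or_gt h ‖x - y‖ with hxy | hxy
    · have h2 := hscale y x
      rw [norm_sub_rev] at h2
      have h3 : 0 ≤ (R + 1 + B + ‖p‖) * (1 + A) * ‖x - y‖ := by positivity
      rw [hK]
      nlinarith
    · refine le_of_forall_pos_le_add fun η hη => ?_
      obtain ⟨w, hw⟩ := happ x (min η h) (lt_min hη h0)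
      have hwR := hbound x w _ (min_le_right _ _) hw
      -- One step from `y` with velocity `w'` lands where `x` lands with `w`, so only the running
      -- costs have to be compared.
      set w' := w + h⁻¹ • (y - x) with hw'
      have e : y - h • w' = x - h • w := by
        rw [hw', smul_add, smul_smul, mul_inv_cancel₀ h0.ne', one_smul]
        abel
      have hn : ‖h⁻¹ • (y - x)‖ = h⁻¹ * ‖x - y‖ := by
        rw [norm_smul, norm_inv, Real.norm_of_nonneg h0.le, norm_sub_rev]
      have hw'R : ‖w'‖ ≤ R + 1 := by
        refine (norm_add_le _ _).trans (add_le_add hwR ?_)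
        rw [hn, inv_mul_le_iff₀ h0]
        linarith
      have h2 := hle y w'
      rw [e] at h2
      have h3 := lagrangian_sub_le hB hA p x y (hwR.trans (by linarith)) hw'R
      rw [hw', add_sub_cancel_left, hn, ← hw', norm_sub_rev y x] at h3
      have h4 := mul_le_mul_of_nonneg_left h3 h0.le
      have h5 : h * ((R + 1 + B + ‖p‖) * (h⁻¹ * ‖x - y‖ + A * ‖x - y‖))
          ≤ (R + 1 + B + ‖p‖) * (1 + A) * ‖x - y‖ := by
        have : h * ((R + 1 + B + ‖p‖) * (h⁻¹ * ‖x - y‖ + A * ‖x - y‖))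
          = (R + 1 + B + ‖p‖) * (1 + h * A) * ‖x - y‖ := by
          field_simp
        rw [this]
        gcongr
        exact mul_le_of_le_one_left hA0 h1.le
      have h6 := min_le_left η h
      have h7 : 0 ≤ 2 * C * ‖x - y‖ := by positivity
      rw [hK]
      linarith
  refine ⟨u, hper, hbd, fun x y => ?_, hle, fun x => ?_⟩
  · have h2 := hlip x y
    have h3 := hlip y x
    rw [norm_sub_rev] at h3
    exact abs_sub_le_iff.2 ⟨h3, h2⟩
  · obtain ⟨w, hw⟩ := happ x (h ^ 2) (by positivity)
    exact ⟨w, hbound x w _ (by nlinarith) hw, hw⟩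

/-! ### Passage to the limit -/

theorem exists_tendsto_of_eventually_mem_closedBall {ι F : Type*} [PseudoMetricSpace F]
    [ProperSpace F] (U : Ultrafilter ι) {f : ι → F} {y : F} {r : ℝ}
    (hf : ∀ᶠ i in (U : Filter ι), f i ∈ Metric.closedBall y r) :
    ∃ z ∈ Metric.closedBall y r, Tendsto f U (𝓝 z) := by
  obtain ⟨z, hz, hle⟩ := (isCompact_closedBall y r).ultrafilter_le_nhds (U.map f)
    (by rw [Filter.le_principal_iff]; exact hf)
  exact ⟨z, hz, hle⟩

/-- Strict differentiability is what is needed here, because the base point `x i` moves along with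
the increment. -/
theorem tendsto_difference_quotient {ι F : Type*} [NormedAddCommGroup F] [NormedSpace ℝ F]
    {l : Filter ι} {ψ : F → ℝ} {ψ' : F →L[ℝ] ℝ} {x₀ w₀ : F} (hψ : HasStrictFDerivAt ψ ψ' x₀)
    {x w : ι → F} {h : ι → ℝ} (hx : Tendsto x l (𝓝 x₀)) (hw : Tendsto w l (𝓝 w₀))
    (hh : Tendsto h l (𝓝[>] 0)) :
    Tendsto (fun i => (ψ (x i - h i • w i) - ψ (x i)) / h i) l (𝓝 (-ψ' w₀)) := by
  have hh0 : Tendsto h l (𝓝 0) := hh.mono_right nhdsWithin_le_nhds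
  have hpos : ∀ᶠ i in l, 0 < h i := hh.eventually self_mem_nhdsWithin
  have hy : Tendsto (fun i => x i - h i • w i) l (𝓝 x₀) := by
    simpa using hx.sub (hh0.smul hw)
  have h1 := hψ.isLittleO.comp_tendsto (hy.prodMk_nhds hx)
  have h2 : (fun i => ψ (x i - h i • w i) - ψ (x i) - ψ' (x i - h i • w i - x i)) =o[l] h := by
    refine h1.trans_isBigO ?_
    have h3 : (fun i => h i • w i) =O[l] h := by
      simpa using (Asymptotics.isBigO_refl h l).smul (hw.isBigO_one ℝ)
    simpa [Function.comp_def] using h3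
  have h4 := h2.tendsto_div_nhds_zero
  have h5 : Tendsto (fun i => ψ' (w i)) l (𝓝 (ψ' w₀)) := (ψ'.continuous.tendsto _).comp hw
  have h6 := h4.sub h5
  rw [zero_sub] at h6
  refine h6.congr' ?_
  filter_upwards [hpos] with i hi
  rw [sub_sub_cancel_left, map_neg, map_smul, smul_eq_mul]
  field_simp
  ring

/-- A local maximum of `u - φ` is a limit of maxima of `v i - ψ`, where `ψ` is a perturbation of
`φ` with the same derivative at that point and `v i → u` with a common Lipschitz constant. -/
theorem exists_tendsto_isMax {ι F : Type*} [NormedAddCommGroup F] [InnerProductSpace ℝ F]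
    [ProperSpace F] (U : Ultrafilter ι) {v : ι → F → ℝ} {u φ : F → ℝ} {K : ℝ}
    (hv : ∀ᶠ i in (U : Filter ι), ∀ x y, |v i x - v i y| ≤ K * ‖x - y‖)
    (hu : ∀ x, Tendsto (fun i => v i x) U (𝓝 (u x))) (hφ : ContDiff ℝ 1 φ) {x₀ : F}
    (hmax : IsLocalMax (fun y => u y - φ y) x₀) :
    ∃ ψ : F → ℝ, HasStrictFDerivAt ψ (fderiv ℝ φ x₀) x₀ ∧ ∃ x : ι → F, Tendsto x U (𝓝 x₀) ∧
      ∃ r > 0, ∀ᶠ i in (U : Filter ι), ∀ y ∈ Metric.closedBall x₀ r,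
        v i y - ψ y ≤ v i (x i) - ψ (x i) := by
  obtain ⟨r, hr, hball⟩ := Metric.nhds_basis_closedBall.eventually_iff.1 hmax
  -- The quadratic penalty makes the maximum at `x₀` strict, which forces the maximisers of `v i -
  -- ψ` to converge to `x₀`.
  set ψ : F → ℝ := fun y => φ y + ‖y - x₀‖ ^ 2 with hψ
  have hψc : Continuous ψ := by
    have := hφ.continuous
    fun_prop
  have hvc : ∀ᶠ i in (U : Filter ι), Continuous (v i) := by
    filter_upwards [hv] with i hi
    have : LipschitzWith K.toNNReal (v i) := LipschitzWith.of_dist_le' fun x y => by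
      rw [Real.dist_eq, dist_eq_norm]; exact hi x y
    exact this.continuous
  -- The functions `v i` are continuous only eventually; for the other indices the chosen point is
  -- irrelevant.
  have hex : ∀ i, ∃ x, Continuous (v i) → x ∈ Metric.closedBall x₀ r ∧
      ∀ y ∈ Metric.closedBall x₀ r, v i y - ψ y ≤ v i x - ψ x := by
    intro i
    by_cases hc : Continuous (v i)
    · obtain ⟨x, hx, hmx⟩ := (isCompact_closedBall x₀ r).exists_isMaxOn
        ⟨x₀, Metric.mem_closedBall_self hr.le⟩ (hc.sub hψc).continuousOn
      exact ⟨x, fun _ => ⟨hx, fun y hy => hmx hy⟩⟩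
    · exact ⟨x₀, fun h => absurd h hc⟩
  choose x hx using hex
  refine ⟨ψ, ?_, x, ?_, r, hr, ?_⟩
  · have h1 : HasStrictFDerivAt φ (fderiv ℝ φ x₀) x₀ :=
      hφ.contDiffAt.hasStrictFDerivAt one_ne_zero
    have h2 : HasStrictFDerivAt (fun y : F => ‖y - x₀‖ ^ 2) (0 : F →L[ℝ] ℝ) x₀ := by
      have hc : ContDiff ℝ 1 (fun y : F => ‖y - x₀‖ ^ 2) :=
        (contDiff_id.sub contDiff_const).norm_sq ℝ
      have hmin : IsLocalMin (fun y : F => ‖y - x₀‖ ^ 2) x₀ :=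
        Eventually.of_forall fun y => by simp
      rw [← hmin.fderiv_eq_zero]
      exact hc.contDiffAt.hasStrictFDerivAt one_ne_zero
    have h3 := h1.add h2
    rw [add_zero] at h3
    exact h3
  · obtain ⟨z, hz, hlim⟩ := exists_tendsto_of_eventually_mem_closedBall U (f := x)
      (hvc.mono fun i hi => (hx i hi).1)
    have hdiff : Tendsto (fun i => v i (x i) - v i z) U (𝓝 0) := by
      refine squeeze_zero_norm' (a := fun i => K * ‖x i - z‖) ?_ ?_
      · filter_upwards [hv] with i hi using hi _ _
      · have : Tendsto (fun i => ‖x i - z‖) U (𝓝 0) :=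
          tendsto_iff_norm_sub_tendsto_zero.1 hlim
        simpa using this.const_mul K
    have hvx : Tendsto (fun i => v i (x i)) U (𝓝 (u z)) := by
      simpa using hdiff.add (hu z)
    have hle : u x₀ - ψ x₀ ≤ u z - ψ z :=
      le_of_tendsto_of_tendsto ((hu x₀).sub_const _) (hvx.sub ((hψc.tendsto z).comp hlim))
        (hvc.mono fun i hi => (hx i hi).2 x₀ (Metric.mem_closedBall_self hr.le))
    have hle' : u z - φ z ≤ u x₀ - φ x₀ := hball hz
    have : ‖z - x₀‖ ^ 2 ≤ 0 := by
      simp only [hψ, sub_self, norm_zero] at hle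
      linarith
    have hz0 : z = x₀ := by
      rw [← sub_eq_zero, ← norm_eq_zero]
      exact pow_eq_zero_iff two_ne_zero |>.1 (le_antisymm this (sq_nonneg _))
    rwa [hz0] at hlim
  · filter_upwards [hvc] with i hi using (hx i hi).2

theorem inner_gradient_eq_fderiv {F : Type*} [NormedAddCommGroup F] [InnerProductSpace ℝ F]
    [CompleteSpace F] (φ : F → ℝ) (x w : F) : inner ℝ (gradient φ x) w = fderiv ℝ φ x w := by
  rw [gradient, InnerProductSpace.toDual_symm_apply]

section Limit

variable {V : EuclideanSpace ℝ (Fin n) → EuclideanSpace ℝ (Fin n)} {p : EuclideanSpace ℝ (Fin n)}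
  {U : Ultrafilter ℝ} {u : ℝ → EuclideanSpace ℝ (Fin n) → ℝ} {u₀ : EuclideanSpace ℝ (Fin n) → ℝ}
  {K R d : ℝ}

theorem tendsto_lagrangian {ι : Type*} {l : Filter ι} (hV : Continuous V)
    (p : EuclideanSpace ℝ (Fin n)) {x w : ι → EuclideanSpace ℝ (Fin n)}
    {x₀ w₀ : EuclideanSpace ℝ (Fin n)} (hx : Tendsto x l (𝓝 x₀)) (hw : Tendsto w l (𝓝 w₀)) :
    Tendsto (fun i => lagrangian V p (x i) (w i)) l (𝓝 (lagrangian V p x₀ w₀)) := by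
  have h1 : Tendsto (fun i => V (x i)) l (𝓝 (V x₀)) := (hV.tendsto x₀).comp hx
  have h2 : Tendsto (fun _ : ι => p) l (𝓝 p) := tendsto_const_nhds
  exact (((hw.sub h1).norm.pow 2).div_const 4).sub (h2.inner hw)

/-- The one-step inequality holds for every velocity. It is used at the approximate maxima with the
Fenchel-optimal velocity for `gradient φ x₀`, divided by `h`, and passed to the limit. -/
theorem isViscositySubsolution_of_tendsto (hV : Continuous V)
    (hU : Tendsto (fun h : ℝ => h) U (𝓝[>] 0))
    (hlip : ∀ᶠ h in (U : Filter ℝ), ∀ x y,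
      |(u h x - u h 0) - (u h y - u h 0)| ≤ K * ‖x - y‖)
    (hu₀ : ∀ x, Tendsto (fun h => u h x - u h 0) U (𝓝 (u₀ x)))
    (hd : ∀ (y : ℝ → EuclideanSpace ℝ (Fin n)) (z : EuclideanSpace ℝ (Fin n)),
      Tendsto y U (𝓝 z) → Tendsto (fun h => h * u h (y h)) U (𝓝 d))
    (hle : ∀ᶠ h in (U : Filter ℝ), ∀ x w,
      u h x ≤ (1 - h ^ 2) * u h (x - h • w) + h * lagrangian V p x w) :
    IsViscositySubsolution (fun q x => hamiltonian V (p + q) x) (-d) u₀ := by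
  intro φ hφ x₀ hmax
  obtain ⟨ψ, hψ, x, hx, r, hr, hm⟩ := exists_tendsto_isMax U hlip hu₀ hφ hmax
  obtain ⟨w, hw⟩ : ∃ w : EuclideanSpace ℝ (Fin n), w = V x₀ + (2 : ℝ) • (p + gradient φ x₀) :=
    exists_eq
  have hU0 : Tendsto (fun h : ℝ => h) U (𝓝 0) := hU.mono_right nhdsWithin_le_nhds
  have hy : Tendsto (fun h => x h - h • w) U (𝓝 x₀) := by
    have := hx.sub (hU0.smul_const w)
    rwa [zero_smul, sub_zero] at this
  have h1 := tendsto_difference_quotient hψ hx (tendsto_const_nhds (x := w)) hU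
  have h2 : Tendsto (fun h => lagrangian V p (x h) w) U (𝓝 (lagrangian V p x₀ w)) :=
    tendsto_lagrangian hV p hx tendsto_const_nhds
  have h3 : d ≤ -(fderiv ℝ φ x₀) w + lagrangian V p x₀ w := by
    refine le_of_tendsto_of_tendsto (hd _ _ hy) (h1.add h2) ?_
    filter_upwards [hU.eventually self_mem_nhdsWithin, hle, hm,
      hy.eventually (Metric.closedBall_mem_nhds x₀ hr)] with h h0 hle hm hmem
    have h0 : 0 < h := h0
    have h4 := hm _ hmem
    have h5 := hle (x h) w
    have h6 : ψ (x h - h • w) - ψ (x h)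
        = h * ((ψ (x h - h • w) - ψ (x h)) / h) := by field_simp
    have h8 : h * (h * u h (x h - h • w))
        ≤ h * ((ψ (x h - h • w) - ψ (x h)) / h + lagrangian V p (x h) w) := by
      rw [mul_add, ← h6]
      linarith
    exact le_of_mul_le_mul_left h8 h0
  have h7 := lagrangian_optimal V p (gradient φ x₀) x₀
  rw [← hw, inner_gradient_eq_fderiv] at h7
  simp only
  linarith

/-- Near-optimal velocities stay in a fixed ball, hence converge along the ultrafilter; the Fenchel
inequality at their limit finishes. Minima become maxima after changing all signs. -/
theorem isViscositySupersolution_of_tendsto (hV : Continuous V)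
    (hU : Tendsto (fun h : ℝ => h) U (𝓝[>] 0))
    (hlip : ∀ᶠ h in (U : Filter ℝ), ∀ x y,
      |(u h x - u h 0) - (u h y - u h 0)| ≤ K * ‖x - y‖)
    (hu₀ : ∀ x, Tendsto (fun h => u h x - u h 0) U (𝓝 (u₀ x)))
    (hd : ∀ (y : ℝ → EuclideanSpace ℝ (Fin n)) (z : EuclideanSpace ℝ (Fin n)),
      Tendsto y U (𝓝 z) → Tendsto (fun h => h * u h (y h)) U (𝓝 d))
    (happ : ∀ᶠ h in (U : Filter ℝ), ∀ x, ∃ w, ‖w‖ ≤ R ∧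
      (1 - h ^ 2) * u h (x - h • w) + h * lagrangian V p x w ≤ u h x + h ^ 2) :
    IsViscositySupersolution (fun q x => hamiltonian V (p + q) x) (-d) u₀ := by
  intro φ hφ x₀ hmin
  obtain ⟨ψ, hψ, x, hx, r, hr, hm⟩ := exists_tendsto_isMax U
    (v := fun h y => -(u h y - u h 0)) (u := fun y => -u₀ y) (φ := fun y => -φ y) (K := K)
    (hlip.mono fun h hh x y => by rw [← abs_neg]; convert hh x y using 2; ring)
    (fun y => (hu₀ y).neg) hφ.neg (x₀ := x₀) (by
      refine hmin.neg.congr (Eventually.of_forall fun y => ?_)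
      simp only
      ring)
  have hU0 : Tendsto (fun h : ℝ => h) U (𝓝 0) := hU.mono_right nhdsWithin_le_nhds
  obtain ⟨w, hw⟩ := Filter.skolem.1 (happ.mono fun h hh => hh (x h))
  obtain ⟨w₀, -, hw₀⟩ := exists_tendsto_of_eventually_mem_closedBall U (f := w) (y := 0) (r := R)
    (hw.mono fun h hh => by simpa using hh.1)
  have hy : Tendsto (fun h => x h - h • w h) U (𝓝 x₀) := by
    have := hx.sub (hU0.smul hw₀)
    rwa [zero_smul, sub_zero] at this
  have h1 := tendsto_difference_quotient hψ hx hw₀ hU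
  have h2 : Tendsto (fun h => lagrangian V p (x h) (w h)) U (𝓝 (lagrangian V p x₀ w₀)) :=
    tendsto_lagrangian hV p hx hw₀
  have h3 : -(-(fderiv ℝ (fun y => -φ y) x₀) w₀) - d + lagrangian V p x₀ w₀ ≤ 0 := by
    refine le_of_tendsto_of_tendsto ((h1.neg.sub (hd _ _ hy)).add h2) hU0 ?_
    filter_upwards [hU.eventually self_mem_nhdsWithin, hw, hm,
      hy.eventually (Metric.closedBall_mem_nhds x₀ hr)] with h h0 hw hm hmem
    have h0 : 0 < h := h0
    have h4 := hm _ hmem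
    have h5 := hw.2
    have h6 : ψ (x h - h • w h) - ψ (x h)
        = h * ((ψ (x h - h • w h) - ψ (x h)) / h) := by field_simp
    have h8 : h * (-((ψ (x h - h • w h) - ψ (x h)) / h) - h * u h (x h - h • w h)
        + lagrangian V p (x h) (w h)) ≤ h * h := by
      rw [mul_add, mul_sub, mul_neg, ← h6]
      linarith
    exact le_of_mul_le_mul_left h8 h0
  have h7 := inner_sub_hamiltonian_le_lagrangian V p (gradient φ x₀) x₀ w₀
  rw [inner_gradient_eq_fderiv] at h7
  rw [show (fun y => -φ y) = -φ from rfl, fderiv_neg] at h3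
  simp only [neg_apply] at h3
  simp only
  linarith

end Limit

theorem exists_isErgodicConstant
    {V : EuclideanSpace ℝ (Fin n) → EuclideanSpace ℝ (Fin n)}
    (hV : IsPeriodic V) {A B : ℝ} (hA0 : 0 ≤ A) (hB : ∀ x, ‖V x‖ ≤ B)
    (hA : ∀ x y, ‖V x - V y‖ ≤ A * ‖x - y‖) (p : EuclideanSpace ℝ (Fin n)) :
    ∃ c, IsErgodicConstant V p c := by
  have hVc : Continuous V := by
    have : LipschitzWith A.toNNReal V := LipschitzWith.of_dist_le' fun x y => by
      rw [dist_eq_norm, dist_eq_norm]; exact hA x y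
    exact this.continuous
  obtain ⟨K, M, R, H⟩ := exists_equiLipschitz_discrete_solution hV hA0 hB hA p
  choose! u hper hbd hlip hle happ using H
  -- Along an ultrafilter bounded quantities converge, so all the limits needed exist at once and no
  -- subsequence is extracted.
  let U : Ultrafilter ℝ := Ultrafilter.of (𝓝[>] 0)
  have hU : Tendsto (fun h : ℝ => h) U (𝓝[>] 0) := Ultrafilter.of_le _
  have hU0 : Tendsto (fun h : ℝ => h) U (𝓝 0) := hU.mono_right nhdsWithin_le_nhds
  have hpos : ∀ᶠ h in (U : Filter ℝ), 0 < h := hU.eventually self_mem_nhdsWithin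
  have hlt : ∀ᶠ h in (U : Filter ℝ), h < 1 := hU0.eventually (gt_mem_nhds one_pos)
  obtain ⟨d, -, hd⟩ := exists_tendsto_of_eventually_mem_closedBall U
    (f := fun h => h * u h 0) (y := 0) (r := M) (by
      filter_upwards [hpos, hlt] with h h0 h1
      simpa using hbd h h0 h1 0)
  have hex : ∀ x, ∃ a, Tendsto (fun h => u h x - u h 0) U (𝓝 a) := fun x => by
    obtain ⟨a, -, ha⟩ := exists_tendsto_of_eventually_mem_closedBall U
      (f := fun h => u h x - u h 0) (y := 0) (r := K * ‖x‖) (by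
        filter_upwards [hpos, hlt] with h h0 h1
        simpa using hlip h h0 h1 x 0)
    exact ⟨a, ha⟩
  choose u₀ hu₀ using hex
  have hlipv : ∀ᶠ h in (U : Filter ℝ), ∀ x y,
      |(u h x - u h 0) - (u h y - u h 0)| ≤ K * ‖x - y‖ := by
    filter_upwards [hpos, hlt] with h h0 h1 x y
    simpa using hlip h h0 h1 x y
  have hd' : ∀ (y : ℝ → EuclideanSpace ℝ (Fin n)) (z : EuclideanSpace ℝ (Fin n)),
      Tendsto y U (𝓝 z) → Tendsto (fun h => h * u h (y h)) U (𝓝 d) := by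
    intro y z hy
    have : Tendsto (fun h => h * (u h (y h) - u h 0)) U (𝓝 0) := by
      refine squeeze_zero_norm' (a := fun h => h * (K * ‖y h‖)) ?_ ?_
      · filter_upwards [hpos, hlt] with h h0 h1
        rw [norm_mul, Real.norm_of_nonneg h0.le]
        gcongr
        simpa using hlip h h0 h1 (y h) 0
      · simpa using hU0.mul (hy.norm.const_mul K)
    have h2 := this.add hd
    rw [zero_add] at h2
    refine h2.congr fun h => ?_
    ring
  refine ⟨-d, u₀, ?_, ⟨K.toNNReal, ?_⟩, ?_, ?_⟩
  · intro x k
    refine tendsto_nhds_unique ((hu₀ (x + intVec k)).congr' ?_) (hu₀ x)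
    filter_upwards [hpos, hlt] with h h0 h1
    rw [hper h h0 h1]
  · refine LipschitzWith.of_dist_le' fun x y => ?_
    rw [Real.dist_eq, dist_eq_norm]
    exact le_of_tendsto ((hu₀ x).sub (hu₀ y)).abs (hlipv.mono fun h hh => hh x y)
  · refine isViscositySubsolution_of_tendsto hVc hU hlipv hu₀ hd' ?_
    filter_upwards [hpos, hlt] with h h0 h1 using hle h h0 h1
  · refine isViscositySupersolution_of_tendsto hVc hU hlipv hu₀ hd' (R := R) ?_
    filter_upwards [hpos, hlt] with h h0 h1 using happ h h0 h1

/-! ### Periodic functions: compactness and Lipschitz bounds -/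

section Periodic

theorem exists_norm_add_intVec_le (n : ℕ) :
    ∃ R : ℝ, 0 ≤ R ∧ ∀ x : EuclideanSpace ℝ (Fin n), ∃ k : Fin n → ℤ, ‖x + intVec k‖ ≤ R := by
  have hc : IsCompact ((fun y : Fin n → ℝ => (WithLp.toLp 2 y : EuclideanSpace ℝ (Fin n))) ''
      Set.pi Set.univ fun _ => Set.Icc 0 1) :=
    (isCompact_univ_pi fun _ => isCompact_Icc).image (PiLp.continuous_toLp 2 _)
  obtain ⟨R, hR⟩ := hc.isBounded.subset_closedBall 0
  refine ⟨max R 0, le_max_right _ _, fun x => ⟨fun i => -⌊x i⌋, ?_⟩⟩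
  have hmem : x + intVec (fun i => -⌊x i⌋) ∈ (fun y : Fin n → ℝ =>
      (WithLp.toLp 2 y : EuclideanSpace ℝ (Fin n))) '' Set.pi Set.univ fun _ => Set.Icc 0 1 := by
    refine ⟨fun i => Int.fract (x i), fun i _ => ⟨Int.fract_nonneg _, (Int.fract_lt_one _).le⟩, ?_⟩
    ext i
    simp [intVec, Int.fract, sub_eq_add_neg]
  have := hR hmem
  rw [mem_closedBall_zero_iff] at this
  exact this.trans (le_max_left _ _)

theorem IsPeriodic.exists_isMax {f : EuclideanSpace ℝ (Fin n) → ℝ} (hf : IsPeriodic f)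
    (hc : Continuous f) : ∃ x, ∀ y, f y ≤ f x := by
  obtain ⟨R, hR0, hR⟩ := exists_norm_add_intVec_le n
  obtain ⟨x, -, hx⟩ := (isCompact_closedBall (0 : EuclideanSpace ℝ (Fin n)) R).exists_isMaxOn
    ⟨0, Metric.mem_closedBall_self hR0⟩ hc.continuousOn
  refine ⟨x, fun y => ?_⟩
  obtain ⟨k, hk⟩ := hR y
  rw [← hf y k]
  exact hx (mem_closedBall_zero_iff.2 hk)

theorem IsPeriodic.exists_norm_le {F : Type*} [NormedAddCommGroup F]
    {f : EuclideanSpace ℝ (Fin n) → F} (hf : IsPeriodic f) (hc : Continuous f) :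
    ∃ C, 0 ≤ C ∧ ∀ x, ‖f x‖ ≤ C := by
  obtain ⟨x, hx⟩ := IsPeriodic.exists_isMax (f := fun x => ‖f x‖) (fun x k => by simp only [hf x k])
    hc.norm
  exact ⟨‖f x‖, norm_nonneg _, hx⟩

theorem IsPeriodic.fderiv {F : Type*} [NormedAddCommGroup F] [NormedSpace ℝ F]
    {f : EuclideanSpace ℝ (Fin n) → F} (hf : IsPeriodic f) : IsPeriodic (fderiv ℝ f) := by
  intro x k
  rw [← fderiv_comp_add_right]
  congr 1
  funext y
  exact hf y k

theorem IsPeriodic.exists_lipschitz {F : Type*} [NormedAddCommGroup F] [NormedSpace ℝ F]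
    {f : EuclideanSpace ℝ (Fin n) → F} (hf : IsPeriodic f) (hc : ContDiff ℝ 1 f) :
    ∃ A, 0 ≤ A ∧ ∀ x y, ‖f x - f y‖ ≤ A * ‖x - y‖ := by
  obtain ⟨A, hA0, hA⟩ := hf.fderiv.exists_norm_le (hc.continuous_fderiv one_ne_zero)
  exact ⟨A, hA0, fun x y => convex_univ.norm_image_sub_le_of_norm_fderiv_le
    (fun z _ => hc.differentiable one_ne_zero z) (fun z _ => hA z) trivial trivial⟩

end Periodic

/-! ### Comparison and uniqueness of the ergodic constant -/

section Comparison

variable {V : EuclideanSpace ℝ (Fin n) → EuclideanSpace ℝ (Fin n)}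
  {q : EuclideanSpace ℝ (Fin n)} {c : ℝ}

/-- By periodicity `w - u` attains a maximum, where `w` is an admissible test function. The
companion bound below uses a maximum of `u - w`. -/
theorem IsErgodicConstant.le_of_forall_hamiltonian_le (hc : IsErgodicConstant V q c)
    {w : EuclideanSpace ℝ (Fin n) → ℝ} (hw : IsPeriodic w) (hw1 : ContDiff ℝ 1 w) {a : ℝ}
    (ha : ∀ x, hamiltonian V (q + gradient w x) x ≤ a) : c ≤ a := by
  obtain ⟨u, hu, ⟨K, hK⟩, -, hsup⟩ := hc
  obtain ⟨x, hx⟩ := IsPeriodic.exists_isMax (f := fun y => w y - u y)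
    (fun y k => by simp only [hw y k, hu y k]) (hw1.continuous.sub hK.continuous)
  refine (hsup w hw1 x (Eventually.of_forall fun y => ?_)).trans (ha x)
  have := hx y
  simp only at this ⊢
  linarith

theorem IsErgodicConstant.le_of_forall_le_hamiltonian (hc : IsErgodicConstant V q c)
    {w : EuclideanSpace ℝ (Fin n) → ℝ} (hw : IsPeriodic w) (hw1 : ContDiff ℝ 1 w) {a : ℝ}
    (ha : ∀ x, a ≤ hamiltonian V (q + gradient w x) x) : a ≤ c := by
  obtain ⟨u, hu, ⟨K, hK⟩, hsub, -⟩ := hc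
  obtain ⟨x, hx⟩ := IsPeriodic.exists_isMax (f := fun y => u y - w y)
    (fun y k => by simp only [hw y k, hu y k]) (hK.continuous.sub hw1.continuous)
  exact (ha x).trans (hsub w hw1 x (Eventually.of_forall fun y => hx y))

theorem gradient_sq_norm_sub (a : ℝ) (y x : EuclideanSpace ℝ (Fin n)) :
    gradient (fun z => a * ‖z - y‖ ^ 2) x = (2 * a) • (x - y) := by
  have h1 : HasFDerivAt (fun z : EuclideanSpace ℝ (Fin n) => ‖z - y‖ ^ 2)
      (2 • innerSL ℝ (x - y)) x := by
    simpa using ((hasFDerivAt_id x).sub_const y).norm_sq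
  have h2 := h1.const_mul a
  have h3 : InnerProductSpace.toDual ℝ (EuclideanSpace ℝ (Fin n)) ((2 * a) • (x - y))
      = a • 2 • innerSL ℝ (x - y) := by
    ext z
    simp
    ring
  refine HasGradientAt.gradient ?_
  rw [hasGradientAt_iff_hasFDerivAt, h3]
  exact h2

/-- Comparison by doubling the variables. -/
theorem le_of_sub_of_super {A : ℝ} (hA0 : 0 ≤ A) (hA : ∀ x y, ‖V x - V y‖ ≤ A * ‖x - y‖)
    {u w : EuclideanSpace ℝ (Fin n) → ℝ} {K L : NNReal} {a b : ℝ}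
    (hu : IsPeriodic u) (hw : IsPeriodic w) (huK : LipschitzWith K u) (hwL : LipschitzWith L w)
    (hsub : IsViscositySubsolution (fun p x => hamiltonian V (q + p) x) a u)
    (hsup : IsViscositySupersolution (fun p x => hamiltonian V (q + p) x) b w) : b ≤ a := by
  obtain ⟨Bu, hBu0, hBu⟩ := hu.exists_norm_le huK.continuous
  obtain ⟨Bw, hBw0, hBw⟩ := hw.exists_norm_le hwL.continuous
  obtain ⟨R, hR0, hR⟩ := exists_norm_add_intVec_le n
  have hwL' : ∀ x y, |w x - w y| ≤ L * ‖x - y‖ := fun x y => by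
    simpa [dist_eq_norm] using hwL.dist_le_mul x y
  have key : ∀ t : ℝ, 0 < t → b - a ≤ t * (A * L * (‖q‖ + 2 * L)) := by
    intro t ht
    -- Beyond distance `S` the penalty exceeds the oscillation of `w`; the added `1` gives `S ≤ S ^
    -- 2`.
    obtain ⟨S, hS⟩ : ∃ S : ℝ, S = 2 * (Bu + Bw) * t + 1 := ⟨_, rfl⟩
    have hS1 : 1 ≤ S := by rw [hS]; linarith [show 0 ≤ 2 * (Bu + Bw) * t by positivity]
    -- The second variable is the difference `y - x`, so that `Ψ` is periodic in the first one and
    -- the maximisation reduces to a compact set.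
    let Ψ : EuclideanSpace ℝ (Fin n) × EuclideanSpace ℝ (Fin n) → ℝ :=
      fun z => u z.1 - w (z.1 + z.2) - t⁻¹ * ‖z.2‖ ^ 2
    have hΨc : Continuous Ψ := by
      have := huK.continuous
      have := hwL.continuous
      fun_prop
    obtain ⟨⟨x, z⟩, -, hmax⟩ := ((isCompact_closedBall (0 : EuclideanSpace ℝ (Fin n)) R).prod
      (isCompact_closedBall (0 : EuclideanSpace ℝ (Fin n)) S)).exists_isMaxOn
      ⟨(0, 0), Metric.mem_closedBall_self hR0, Metric.mem_closedBall_self (by linarith)⟩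
      hΨc.continuousOn
    have hmax' : ∀ x' z', Ψ (x', z') ≤ Ψ (x, z) := by
      have h1 : ∀ x' z', ‖z'‖ ≤ S → Ψ (x', z') ≤ Ψ (x, z) := by
        intro x' z' hz'
        obtain ⟨k, hk⟩ := hR x'
        have e : Ψ (x', z') = Ψ (x' + intVec k, z') := by
          simp only [Ψ]
          rw [hu, show x' + intVec k + z' = x' + z' + intVec k by abel, hw]
        rw [e]
        exact hmax ⟨mem_closedBall_zero_iff.2 hk, mem_closedBall_zero_iff.2 hz'⟩
      intro x' z'
      rcases le_or_gt ‖z'‖ S with hz | hz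
      · exact h1 x' z' hz
      · refine le_trans ?_ (h1 x' 0 (by rw [norm_zero]; linarith))
        have h2 := (abs_le.1 (hBw (x' + z'))).1
        have h3 := (abs_le.1 (hBw x')).2
        have h4 : 2 * (Bu + Bw) ≤ t⁻¹ * ‖z'‖ ^ 2 := by
          rw [le_inv_mul_iff₀ ht]
          nlinarith
        simp only [Ψ, add_zero, norm_zero]
        rw [zero_pow two_ne_zero, mul_zero]
        linarith
    obtain ⟨y, hy⟩ : ∃ y, y = x + z := ⟨_, rfl⟩
    have hz : z = y - x := by rw [hy]; abel
    have hyx : ∀ x' y', u x' - w y' - t⁻¹ * ‖y' - x'‖ ^ 2 ≤ u x - w y - t⁻¹ * ‖y - x‖ ^ 2 := by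
      intro x' y'
      have := hmax' x' (y' - x')
      simp only [Ψ, add_sub_cancel, ← hy] at this
      rwa [hz] at this
    have hcd : ∀ (s : ℝ) (y : EuclideanSpace ℝ (Fin n)),
        ContDiff ℝ 1 (fun v => s * ‖v - y‖ ^ 2) := fun s y =>
      contDiff_const.mul ((contDiff_id.sub contDiff_const).norm_sq ℝ)
    have h1 := hsub _ (hcd t⁻¹ y) x (Eventually.of_forall fun x' => by
      have := hyx x' y
      rw [norm_sub_rev, norm_sub_rev y x] at this
      simp only
      linarith)
    have h2 := hsup _ (hcd (-t⁻¹) x) y (Eventually.of_forall fun y' => by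
      have := hyx x y'
      simp only
      linarith)
    rw [gradient_sq_norm_sub] at h1 h2
    obtain ⟨P, hP⟩ : ∃ P, P = (2 * t⁻¹) • (x - y) := ⟨_, rfl⟩
    have hP' : (2 * -t⁻¹) • (y - x) = P := by rw [hP]; module
    simp only [hP', ← hP, hamiltonian] at h1 h2
    -- Testing maximality at the diagonal point `(x, x)` gives `‖y - x‖ ≤ t * L`. So `P` stays
    -- bounded as `t → 0`; the terms `‖q + P‖ ^ 2` cancel, and the drift terms differ by `O(t)`.
    have h3 : t⁻¹ * ‖y - x‖ ^ 2 ≤ L * ‖y - x‖ := by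
      have h4 := hyx x x
      have h5 := (abs_le.1 (hwL' y x)).1
      simp only [sub_self, norm_zero] at h4
      rw [zero_pow two_ne_zero, mul_zero] at h4
      linarith
    have h6 : ‖y - x‖ ≤ t * L := by
      rcases (norm_nonneg (y - x)).eq_or_lt with h0 | h0
      · rw [← h0]; positivity
      · rw [inv_mul_le_iff₀ ht] at h3
        nlinarith
    have h7 : ‖P‖ ≤ 2 * L := by
      rw [hP, norm_smul, norm_sub_rev, Real.norm_of_nonneg (by positivity), mul_assoc]
      gcongr
      rw [inv_mul_le_iff₀ ht]
      exact h6
    have h8 : inner ℝ (V y) (q + P) - inner ℝ (V x) (q + P) ≤ A * (t * L) * (‖q‖ + 2 * L) := by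
      rw [← inner_sub_left]
      refine (real_inner_le_norm _ _).trans ?_
      gcongr
      · exact (hA y x).trans (by gcongr)
      · exact (norm_add_le _ _).trans (by gcongr)
    linarith
  have hlim : Tendsto (fun t : ℝ => t * (A * L * (‖q‖ + 2 * L))) (𝓝[>] 0) (𝓝 0) := by
    have : Tendsto (fun t : ℝ => t * (A * L * (‖q‖ + 2 * L))) (𝓝 0) (𝓝 (0 * _)) :=
      tendsto_id.mul_const _
    rw [zero_mul] at this
    exact this.mono_left nhdsWithin_le_nhds
  have := ge_of_tendsto hlim (eventually_mem_nhdsWithin.mono key)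
  linarith

theorem existsUnique_isErgodicConstant (hV : IsPeriodic V) (hV1 : ContDiff ℝ 1 V)
    (q : EuclideanSpace ℝ (Fin n)) : ∃! c, IsErgodicConstant V q c := by
  obtain ⟨B, -, hB⟩ := hV.exists_norm_le hV1.continuous
  obtain ⟨A, hA0, hA⟩ := hV.exists_lipschitz hV1
  obtain ⟨c, hc⟩ := exists_isErgodicConstant hV hA0 hB hA q
  have hle : ∀ a b, IsErgodicConstant V q a → IsErgodicConstant V q b → b ≤ a := by
    rintro a b ⟨u, hu, ⟨K, hK⟩, hsub, -⟩ ⟨w, hw, ⟨L, hL⟩, -, hsup⟩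
    exact le_of_sub_of_super hA0 hA hu hw hK hL hsub hsup
  exact ⟨c, hc, fun b hb => le_antisymm (hle _ _ hc hb) (hle _ _ hb hc)⟩

theorem isErgodicConstant_effectiveHamiltonian (hV : IsPeriodic V) (hV1 : ContDiff ℝ 1 V)
    (q : EuclideanSpace ℝ (Fin n)) : IsErgodicConstant V q (effectiveHamiltonian V q) :=
  Classical.epsilon_spec (existsUnique_isErgodicConstant hV hV1 q).exists

end Comparison

/-! ### Integration over the unit cube -/

section CubeIntegral

theorem setIntegral_unitCube {F : Type*} [NormedAddCommGroup F] [NormedSpace ℝ F]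
    (g : EuclideanSpace ℝ (Fin n) → F) :
    ∫ x in unitCube n, g x = ∫ y in Set.Icc (0 : Fin n → ℝ) 1, g (WithLp.toLp 2 y) := by
  have h1 := (PiLp.volume_preserving_toLp (Fin n)).setIntegral_preimage_emb
    (MeasurableEquiv.toLp 2 (Fin n → ℝ)).measurableEmbedding g (unitCube n)
  rw [← h1]
  refine setIntegral_congr_set ?_
  have h2 := Measure.univ_pi_Ico_ae_eq_Icc (μ := fun _ : Fin n => (volume : Measure ℝ))
    (f := 0) (g := 1)
  have h3 : (WithLp.toLp 2 : (Fin n → ℝ) → EuclideanSpace ℝ (Fin n)) ⁻¹' unitCube n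
      = Set.univ.pi fun i => Set.Ico ((0 : Fin n → ℝ) i) ((1 : Fin n → ℝ) i) := by
    ext y
    simp [unitCube]
  rw [h3]
  exact h2

theorem integrableOn_unitCube {F : Type*} [NormedAddCommGroup F]
    {g : EuclideanSpace ℝ (Fin n) → F} (hg : Continuous g) : IntegrableOn g (unitCube n) := by
  have hc : IsCompact ((fun y : Fin n → ℝ => (WithLp.toLp 2 y : EuclideanSpace ℝ (Fin n))) ''
      Set.pi Set.univ fun _ => Set.Icc 0 1) :=
    (isCompact_univ_pi fun _ => isCompact_Icc).image (PiLp.continuous_toLp 2 _)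
  refine (hg.continuousOn.integrableOn_compact hc).mono_set fun x hx => ?_
  exact ⟨WithLp.ofLp x, fun i _ => Set.Ico_subset_Icc_self (hx i), rfl⟩

theorem setIntegral_unitCube_const {F : Type*} [NormedAddCommGroup F] [NormedSpace ℝ F]
    [CompleteSpace F] (c : F) : ∫ _ in unitCube n, c = c := by
  rw [setIntegral_unitCube, setIntegral_const, measureReal_def, Real.volume_Icc_pi_toReal]
  · simp
  · intro i
    simp

theorem norm_setIntegral_unitCube_le {F : Type*} [NormedAddCommGroup F] [NormedSpace ℝ F]
    {g : EuclideanSpace ℝ (Fin n) → F} (hg : Continuous g) {C : ℝ} (hC : ∀ x, ‖g x‖ ≤ C) :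
    ‖∫ x in unitCube n, g x‖ ≤ C := by
  refine (norm_integral_le_integral_norm _).trans ?_
  refine (setIntegral_mono (integrableOn_unitCube hg.norm)
    (integrableOn_unitCube continuous_const) hC).trans ?_
  rw [setIntegral_unitCube_const]

/-- The divergence theorem on the torus. -/
theorem setIntegral_divergence_eq_zero {F : Type*} [NormedAddCommGroup F] [NormedSpace ℝ F]
    (g : Fin n → EuclideanSpace ℝ (Fin n) → F)
    (hg : ∀ i, ContDiff ℝ 1 (g i)) (hper : ∀ i, IsPeriodic (g i)) :
    ∫ x in unitCube n, ∑ i, fderiv ℝ (g i) x (EuclideanSpace.single i 1) = 0 := by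
  rw [setIntegral_unitCube]
  rcases n with _ | m
  · simp
  let e : (Fin (m + 1) → ℝ) →L[ℝ] EuclideanSpace ℝ (Fin (m + 1)) :=
    (EuclideanSpace.equiv (Fin (m + 1)) ℝ).symm
  have he : ∀ y, e y = WithLp.toLp 2 y := fun y => rfl
  have hes : ∀ i, e (Pi.single i 1) = EuclideanSpace.single i 1 := fun i => rfl
  have hdiv := integral_divergence_of_hasFDerivAt_off_countable' (E := F) (0 : Fin (m + 1) → ℝ) 1
    zero_le_one (fun i y => g i (e y)) (fun i y => (fderiv ℝ (g i) (e y)).comp e) ∅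
    Set.countable_empty (fun i => ((hg i).continuous.comp e.continuous).continuousOn)
    (fun y _ i => (((hg i).differentiable one_ne_zero (e y)).hasFDerivAt).comp y e.hasFDerivAt)
    (by
      refine Continuous.integrableOn_Icc (continuous_finsetSum _ fun i _ => ?_)
      have := (hg i).continuous_fderiv one_ne_zero
      simp only [ContinuousLinearMap.comp_apply]
      fun_prop)
  simp only [ContinuousLinearMap.comp_apply, hes, he] at hdiv
  rw [hdiv]
  refine Finset.sum_eq_zero fun i _ => ?_
  rw [sub_eq_zero]
  refine integral_congr_ae (Eventually.of_forall fun y => ?_)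
  simp only [Pi.one_apply, Pi.zero_apply]
  -- Opposite faces differ by a lattice vector, so their fluxes cancel.
  rw [← hper i (WithLp.toLp 2 (Fin.insertNth i 0 y)) (Pi.single i 1)]
  congr 1
  ext j
  refine Fin.succAboveCases i ?_ (fun j => ?_) j <;> simp [intVec]

theorem setIntegral_fderiv_eq_zero {F : Type*} [NormedAddCommGroup F] [NormedSpace ℝ F]
    {g : EuclideanSpace ℝ (Fin n) → F} (hg : ContDiff ℝ 1 g) (hper : IsPeriodic g) (j : Fin n) :
    ∫ x in unitCube n, fderiv ℝ g x (EuclideanSpace.single j 1) = 0 := by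
  have := setIntegral_divergence_eq_zero (fun i => if i = j then g else 0)
    (fun i => by
      split_ifs
      · exact hg
      · exact contDiff_const)
    (fun i => by
      split_ifs
      · exact hper
      · intro x k; rfl)
  rw [← this]
  refine integral_congr_ae (Eventually.of_forall fun x => ?_)
  simp only
  rw [Finset.sum_eq_single j]
  · simp
  · intro i _ hij
    simp [hij]
  · simp

end CubeIntegral

/-! ### Characters and Fourier coefficients -/

section Modes

open Complex in
/-- The character `x ↦ e^{2πi k·x}` of the torus. -/
def fourierMode (k : Fin n → ℤ) (x : EuclideanSpace ℝ (Fin n)) : ℂ :=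
  exp (2 * Real.pi * I * (inner ℝ (intVec k) x : ℝ))

theorem intVec_neg (k : Fin n → ℤ) : intVec (-k) = -intVec k := by
  ext i
  simp [intVec]

theorem intVec_zero : intVec (0 : Fin n → ℤ) = 0 := by
  ext i
  simp [intVec]

theorem fourierMode_zero (x : EuclideanSpace ℝ (Fin n)) : fourierMode 0 x = 1 := by
  simp [fourierMode, intVec_zero]

theorem norm_fourierMode (k : Fin n → ℤ) (x : EuclideanSpace ℝ (Fin n)) :
    ‖fourierMode k x‖ = 1 := by
  rw [fourierMode, show (2 * Real.pi * Complex.I * (inner ℝ (intVec k) x : ℝ) : ℂ)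
    = ((2 * Real.pi * inner ℝ (intVec k) x : ℝ) : ℂ) * Complex.I by push_cast; ring]
  exact Complex.norm_exp_ofReal_mul_I _

theorem hasFDerivAt_fourierMode (k : Fin n → ℤ) (x : EuclideanSpace ℝ (Fin n)) :
    HasFDerivAt (fourierMode k) ((2 * Real.pi * Complex.I * fourierMode k x) •
      (Complex.ofRealCLM.comp (innerSL ℝ (intVec k)))) x := by
  have h1 : HasFDerivAt (fun x : EuclideanSpace ℝ (Fin n) =>
      ((inner ℝ (intVec k) x : ℝ) : ℂ)) (Complex.ofRealCLM.comp (innerSL ℝ (intVec k))) x :=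
    (Complex.ofRealCLM.comp (innerSL ℝ (intVec k))).hasFDerivAt
  have h2 := (h1.const_mul (2 * Real.pi * Complex.I)).cexp
  rw [smul_smul, mul_comm (Complex.exp _)] at h2
  exact h2

theorem contDiff_fourierMode (k : Fin n → ℤ) {m : WithTop ℕ∞} :
    ContDiff ℝ m (fourierMode k) := by
  have h1 : ContDiff ℝ m fun x : EuclideanSpace ℝ (Fin n) => ((inner ℝ (intVec k) x : ℝ) : ℂ) :=
    (Complex.ofRealCLM.comp (innerSL ℝ (intVec k))).contDiff
  exact (contDiff_const.mul h1).cexp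

theorem continuous_fourierMode (k : Fin n → ℤ) : Continuous (fourierMode k) :=
  (contDiff_fourierMode k (m := 0)).continuous

theorem fourierMode_eq_mFourier (k : Fin n → ℤ) (x : EuclideanSpace ℝ (Fin n)) :
    fourierMode k x = UnitAddTorus.mFourier k (fun i => (x i : UnitAddCircle)) := by
  simp only [UnitAddTorus.mFourier, ContinuousMap.coe_mk, fourier_coe_apply, fourierMode]
  rw [← Complex.exp_sum]
  congr 1
  simp only [PiLp.inner_apply, intVec, Complex.ofReal_sum, Finset.mul_sum]
  refine Finset.sum_congr rfl fun i _ => ?_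
  simp
  ring

theorem isPeriodic_fourierMode (k : Fin n → ℤ) : IsPeriodic (fourierMode k) := by
  intro x m
  rw [fourierMode_eq_mFourier, fourierMode_eq_mFourier]
  congr 1
  funext i
  simp [intVec]

/-- The Fourier coefficient of a scalar function on the torus. -/
def torusCoeff (g : EuclideanSpace ℝ (Fin n) → ℂ) (k : Fin n → ℤ) : ℂ :=
  ∫ x in unitCube n, fourierMode (-k) x * g x

/-- Integration by parts: the derivative of `fourierMode (-k) * g` has integral zero. -/
theorem torusCoeff_fderiv {g : EuclideanSpace ℝ (Fin n) → ℂ} (hg : ContDiff ℝ 1 g)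
    (hper : IsPeriodic g) (k : Fin n → ℤ) (j : Fin n) :
    torusCoeff (fun x => fderiv ℝ g x (EuclideanSpace.single j 1)) k
      = 2 * Real.pi * Complex.I * k j * torusCoeff g k := by
  have h0 := setIntegral_fderiv_eq_zero ((contDiff_fourierMode (-k)).mul hg)
    (fun x m => by simp only [isPeriodic_fourierMode (-k) x m, hper x m]) j
  have hd : ∀ x, fderiv ℝ (fun x => fourierMode (-k) x * g x) x (EuclideanSpace.single j 1)
      = fourierMode (-k) x * fderiv ℝ g x (EuclideanSpace.single j 1)
        - (2 * Real.pi * Complex.I * k j) * (fourierMode (-k) x * g x) := by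
    intro x
    have h1 := (hasFDerivAt_fourierMode (-k) x).mul
      (hg.differentiable one_ne_zero x).hasFDerivAt
    have h2 : HasFDerivAt (fun x => fourierMode (-k) x * g x) _ x := h1
    rw [h2.fderiv]
    simp [intVec, EuclideanSpace.inner_single_right]
    ring
  have hc1 : Continuous fun x => fourierMode (-k) x * fderiv ℝ g x (EuclideanSpace.single j 1) := by
    have := (hg.continuous_fderiv one_ne_zero)
    have := continuous_fourierMode (-k)
    fun_prop
  have hc2 : Continuous fun x => (2 * Real.pi * Complex.I * k j) * (fourierMode (-k) x * g x) :=
    continuous_const.mul ((continuous_fourierMode (-k)).mul hg.continuous)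
  simp only [hd] at h0
  rw [integral_sub (integrableOn_unitCube hc1) (integrableOn_unitCube hc2),
    integral_const_mul, sub_eq_zero] at h0
  exact h0

theorem norm_torusCoeff_le {g : EuclideanSpace ℝ (Fin n) → ℂ} (hg : Continuous g) {C : ℝ}
    (hC : ∀ x, ‖g x‖ ≤ C) (k : Fin n → ℤ) : ‖torusCoeff g k‖ ≤ C :=
  norm_setIntegral_unitCube_le ((continuous_fourierMode _).mul hg) fun x => by
    change ‖fourierMode (-k) x * g x‖ ≤ C
    rw [norm_mul, norm_fourierMode, one_mul]
    exact hC x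

/-- Differentiating a constant gives `0 = 2πi k_j` times the coefficient, and some `k_j` is nonzero.
-/
theorem torusCoeff_const_of_ne_zero (c : ℂ) {k : Fin n → ℤ} (hk : k ≠ 0) :
    torusCoeff (fun _ => c) k = 0 := by
  obtain ⟨j, hj⟩ := Function.ne_iff.1 hk
  have h := torusCoeff_fderiv (g := fun _ => c) contDiff_const (fun _ _ => rfl) k j
  have h0 : torusCoeff (fun x => fderiv ℝ (fun _ => c) x (EuclideanSpace.single j 1)) k = 0 := by
    simp [torusCoeff]
  rw [h0] at h
  have hj' : (k j : ℂ) ≠ 0 := by exact_mod_cast hj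
  have : (2 * Real.pi * Complex.I * k j : ℂ) ≠ 0 := by
    have := Complex.I_ne_zero
    have : (Real.pi : ℂ) ≠ 0 := by exact_mod_cast Real.pi_ne_zero
    simp_all
  exact (mul_eq_zero.1 h.symm).resolve_left this

theorem setIntegral_fourierMode_of_ne_zero {k : Fin n → ℤ} (hk : k ≠ 0) :
    ∫ x in unitCube n, fourierMode k x = 0 := by
  have := torusCoeff_const_of_ne_zero 1 (neg_ne_zero.2 hk)
  simpa [torusCoeff] using this

end Modes

/-! ### Rapid decay of Fourier coefficients -/

section Decay

theorem intVec_injective : Function.Injective (intVec (n := n)) := by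
  intro k l h
  funext i
  have := congrArg (fun x : EuclideanSpace ℝ (Fin n) => x i) h
  simpa [intVec] using this

theorem intVec_mem_span (k : Fin n → ℤ) :
    intVec k ∈ Submodule.span ℤ (Set.range (EuclideanSpace.basisFun (Fin n) ℝ).toBasis) := by
  have : intVec k = ∑ i, k i • (EuclideanSpace.basisFun (Fin n) ℝ).toBasis i := by
    ext j
    simp [intVec, Finset.sum_apply, Pi.single_apply]
  rw [this]
  exact Submodule.sum_mem _ fun i _ => Submodule.smul_mem _ _ (Submodule.subset_span ⟨i, rfl⟩)

theorem summable_norm_inv_pow_of_mem {L : Submodule ℤ (EuclideanSpace ℝ (Fin n))}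
    (hL : ∀ k, intVec k ∈ L) {m : ℕ} (h : Summable fun z : L => ‖z‖⁻¹ ^ m) :
    Summable fun k : Fin n → ℤ => ‖intVec k‖⁻¹ ^ m := by
  have hinj : Function.Injective fun k : Fin n → ℤ => (⟨intVec k, hL k⟩ : L) :=
    fun k l hkl => intVec_injective (congrArg Subtype.val hkl)
  have e : ∀ k, ‖(⟨intVec k, hL k⟩ : L)‖ = ‖intVec k‖ := fun _ => rfl
  have h3 := h.comp_injective hinj
  simpa only [Function.comp_def, e] using h3

theorem summable_norm_intVec_inv_pow :
    Summable fun k : Fin n → ℤ => ‖intVec k‖⁻¹ ^ (n + 1) := by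
  refine summable_norm_inv_pow_of_mem intVec_mem_span (ZLattice.summable_norm_pow_inv _ (n + 1) ?_)
  rw [ZLattice.rank ℝ, finrank_euclideanSpace_fin]
  exact Nat.lt_succ_self n

theorem norm_intVec_le_of_forall_abs_le {k : Fin n → ℤ} {j : Fin n}
    (hj : ∀ i, |(k i : ℝ)| ≤ |(k j : ℝ)|) : ‖intVec k‖ ≤ n * |(k j : ℝ)| := by
  have hn : (1 : ℝ) ≤ n := by
    have := j.pos
    exact_mod_cast this
  rw [EuclideanSpace.norm_eq, Real.sqrt_le_iff]
  refine ⟨by positivity, ?_⟩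
  calc ∑ i, ‖intVec k i‖ ^ 2 ≤ ∑ _i : Fin n, |(k j : ℝ)| ^ 2 := by
        refine Finset.sum_le_sum fun i _ => ?_
        exact pow_le_pow_left₀ (norm_nonneg _) (hj i) 2
    _ = n * |(k j : ℝ)| ^ 2 := by simp
    _ ≤ (n * |(k j : ℝ)|) ^ 2 := by nlinarith [sq_nonneg |(k j : ℝ)|]

theorem one_le_norm_intVec {k : Fin n → ℤ} (hk : k ≠ 0) : 1 ≤ ‖intVec k‖ := by
  obtain ⟨j, hj⟩ := Function.ne_iff.1 hk
  have h1 : ‖intVec k j‖ ≤ ‖intVec k‖ := PiLp.norm_apply_le _ _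
  refine le_trans ?_ h1
  have : 1 ≤ |k j| := Int.one_le_abs hj
  simp only [intVec, Real.norm_eq_abs]
  exact_mod_cast this

/-- Induction on `m` with `g` replaced by its `j`-th partial derivative: each derivative yields a
factor `2π |k_j| ≥ |k_j|`. -/
theorem exists_abs_pow_mul_norm_torusCoeff_le (m : ℕ) (j : Fin n) :
    ∀ g : EuclideanSpace ℝ (Fin n) → ℂ, ContDiff ℝ ∞ g → IsPeriodic g →
      ∃ C, ∀ k : Fin n → ℤ, |(k j : ℝ)| ^ m * ‖torusCoeff g k‖ ≤ C := by
  induction m with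
  | zero =>
    intro g hg hper
    obtain ⟨C, -, hC⟩ := hper.exists_norm_le hg.continuous
    exact ⟨C, fun k => by simpa using norm_torusCoeff_le hg.continuous hC k⟩
  | succ m ih =>
    intro g hg hper
    obtain ⟨C, hC⟩ := ih (fun x => fderiv ℝ g x (EuclideanSpace.single j 1))
      ((hg.fderiv_right (m := ∞) (by simp)).clm_apply contDiff_const)
      (fun x k => by simp only [hper.fderiv x k])
    refine ⟨C, fun k => le_trans ?_ (hC k)⟩
    rw [torusCoeff_fderiv (hg.of_le (by exact_mod_cast le_top)) hper, norm_mul, pow_succ, mul_assoc]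
    have h2 : ‖(2 * Real.pi * Complex.I * k j : ℂ)‖ = 2 * Real.pi * |(k j : ℝ)| := by
      simp [abs_of_pos Real.pi_pos]
    rw [h2]
    have h3 : |(k j : ℝ)| ≤ 2 * Real.pi * |(k j : ℝ)| := by
      have := Real.two_le_pi
      nlinarith [abs_nonneg (k j : ℝ)]
    gcongr

theorem exists_norm_pow_mul_norm_torusCoeff_le {g : EuclideanSpace ℝ (Fin n) → ℂ}
    (hg : ContDiff ℝ ∞ g) (hper : IsPeriodic g) (m : ℕ) :
    ∃ C, ∀ k : Fin n → ℤ, ‖intVec k‖ ^ m * ‖torusCoeff g k‖ ≤ C := by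
  have h := fun j => exists_abs_pow_mul_norm_torusCoeff_le m j g hg hper
  choose C hC using h
  have hC0 : ∀ j, 0 ≤ C j := fun j => le_trans (by positivity) (hC j 0)
  refine ⟨‖torusCoeff g 0‖ + ∑ j, n ^ m * C j, fun k => ?_⟩
  have hs : 0 ≤ ∑ j, (n : ℝ) ^ m * C j :=
    Finset.sum_nonneg fun j _ => mul_nonneg (by positivity) (hC0 j)
  by_cases hk : k = 0
  · subst hk
    have h1 : ‖intVec (0 : Fin n → ℤ)‖ ^ m ≤ 1 := by
      rw [intVec_zero, norm_zero]
      exact pow_le_one₀ le_rfl zero_le_one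
    have := mul_le_mul_of_nonneg_right h1 (norm_nonneg (torusCoeff g 0))
    linarith
  · obtain ⟨i, -⟩ := Function.ne_iff.1 hk
    -- The largest coordinate controls the whole norm, up to the factor `n`.
    obtain ⟨j, -, hj⟩ := Finset.exists_max_image Finset.univ (fun i => |(k i : ℝ)|) ⟨i, by simp⟩
    have h1 := norm_intVec_le_of_forall_abs_le fun i => hj i (Finset.mem_univ i)
    have h2 : ‖intVec k‖ ^ m * ‖torusCoeff g k‖ ≤ n ^ m * C j := by
      calc ‖intVec k‖ ^ m * ‖torusCoeff g k‖
          ≤ (n * |(k j : ℝ)|) ^ m * ‖torusCoeff g k‖ := by gcongr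
        _ = n ^ m * (|(k j : ℝ)| ^ m * ‖torusCoeff g k‖) := by rw [mul_pow]; ring
        _ ≤ n ^ m * C j := by gcongr; exact hC j k
    have h3 : (n : ℝ) ^ m * C j ≤ ∑ j, (n : ℝ) ^ m * C j :=
      Finset.single_le_sum (f := fun j => (n : ℝ) ^ m * C j)
        (fun j _ => mul_nonneg (by positivity) (hC0 j)) (Finset.mem_univ j)
    linarith [norm_nonneg (torusCoeff g 0)]

theorem summable_norm_pow_mul_norm_torusCoeff {g : EuclideanSpace ℝ (Fin n) → ℂ}
    (hg : ContDiff ℝ ∞ g) (hper : IsPeriodic g) (m : ℕ) :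
    Summable fun k : Fin n → ℤ => ‖intVec k‖ ^ m * ‖torusCoeff g k‖ := by
  -- The `n + 1` additional powers pay for summing over the lattice, which has rank `n`.
  obtain ⟨C, hC⟩ := exists_norm_pow_mul_norm_torusCoeff_le hg hper (m + (n + 1))
  refine Summable.of_norm_bounded_eventually (summable_norm_intVec_inv_pow.mul_left C) ?_
  have : ∀ᶠ k : Fin n → ℤ in cofinite, k ≠ 0 := (Set.finite_singleton 0).compl_mem_cofinite
  filter_upwards [this] with k hk
  have h1 : 0 < ‖intVec k‖ := one_pos.trans_le (one_le_norm_intVec hk)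
  rw [Real.norm_of_nonneg (by positivity), inv_pow, ← div_eq_mul_inv, le_div_iff₀ (by positivity)]
  have := hC k
  rw [pow_add] at this
  linarith

end Decay

/-! ### Fourier analysis transferred from the quotient torus -/

section TorusBridge

attribute [local instance] instMeasureSpaceUnitAddCircle
  instIsProbabilityMeasureUnitAddCircleVolume

theorem exists_torus_lift {g : EuclideanSpace ℝ (Fin n) → ℂ} (hg : Continuous g)
    (hper : IsPeriodic g) : ∃ G : C(UnitAddTorus (Fin n), ℂ),
      ∀ y : Fin n → ℝ, G (fun i => (y i : UnitAddCircle)) = g (WithLp.toLp 2 y) := by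
  let f : C(Fin n → ℝ, UnitAddTorus (Fin n)) :=
    ⟨fun y i => (y i : UnitAddCircle), continuous_pi fun i =>
      (AddCircle.continuous_mk' (1 : ℝ)).comp (continuous_apply i)⟩
  have hf : Topology.IsQuotientMap f :=
    (IsOpenQuotientMap.piMap fun _ : Fin n =>
      (QuotientAddGroup.isOpenQuotientMap_mk (N := AddSubgroup.zmultiples (1 : ℝ)))).isQuotientMap
  let g' : C(Fin n → ℝ, ℂ) := ⟨fun y => g (WithLp.toLp 2 y), hg.comp (PiLp.continuous_toLp 2 _)⟩
  have hfac : Function.FactorsThrough g' f := by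
    intro y z hyz
    have h1 : ∀ i, ∃ k : ℤ, z i = y i + k := by
      intro i
      have h2 : ((z i - y i : ℝ) : UnitAddCircle) = 0 := by
        have : (y i : UnitAddCircle) = z i := congrFun hyz i
        rw [AddCircle.coe_sub, this, sub_self]
      obtain ⟨k, hk⟩ := (AddCircle.coe_eq_zero_iff (1 : ℝ)).1 h2
      refine ⟨k, ?_⟩
      simp at hk
      linarith
    choose k hk using h1
    change g (WithLp.toLp 2 y) = g (WithLp.toLp 2 z)
    rw [← hper (WithLp.toLp 2 y) k]
    congr 1
    ext i
    simp [intVec, hk]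
  refine ⟨hf.lift g' hfac, fun y => ?_⟩
  have : (hf.lift g' hfac).comp f = g' := hf.lift_comp g' hfac
  exact DFunLike.congr_fun this y

theorem integral_unitAddTorus {F : Type*} [NormedAddCommGroup F] [NormedSpace ℝ F]
    (f : UnitAddTorus (Fin n) → F) :
    ∫ t, f t = ∫ x in unitCube n, f (fun i => (x i : UnitAddCircle)) := by
  rw [UnitAddTorus.integral_preimage f 0, setIntegral_unitCube]
  refine setIntegral_congr_set ?_
  have h2 := Measure.univ_pi_Ioc_ae_eq_Icc (μ := fun _ : Fin n => (volume : Measure ℝ))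
    (f := 0) (g := 1)
  have h3 : {x : Fin n → ℝ | ∀ i, x i ∈ Set.Ioc ((0 : Fin n → ℝ) i) ((0 : Fin n → ℝ) i + 1)}
      = Set.univ.pi fun i => Set.Ioc ((0 : Fin n → ℝ) i) ((1 : Fin n → ℝ) i) := by
    ext y
    simp
  rw [h3]
  exact h2

theorem mFourierCoeff_eq_torusCoeff {g : EuclideanSpace ℝ (Fin n) → ℂ}
    {G : UnitAddTorus (Fin n) → ℂ}
    (hG : ∀ y : Fin n → ℝ, G (fun i => (y i : UnitAddCircle)) = g (WithLp.toLp 2 y))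
    (k : Fin n → ℤ) : UnitAddTorus.mFourierCoeff G k = torusCoeff g k := by
  refine (integral_unitAddTorus fun t => UnitAddTorus.mFourier (-k) t • G t).trans ?_
  refine integral_congr_ae (Eventually.of_forall fun x => ?_)
  simp only
  rw [smul_eq_mul, ← fourierMode_eq_mFourier, hG x]

/-- Parseval's identity for continuous functions. -/
theorem hasSum_sq_torusCoeff {g : EuclideanSpace ℝ (Fin n) → ℂ} (hg : Continuous g)
    (hper : IsPeriodic g) :
    HasSum (fun k => ‖torusCoeff g k‖ ^ 2) (∫ x in unitCube n, ‖g x‖ ^ 2) := by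
  obtain ⟨G, hG⟩ := exists_torus_lift hg hper
  have h1 := UnitAddTorus.hasSum_sq_mFourierCoeff (ContinuousMap.toLp (E := ℂ) 2 volume ℂ G)
  simp only [UnitAddTorus.mFourierCoeff_toLp, mFourierCoeff_eq_torusCoeff hG] at h1
  convert h1 using 1
  have h2 : ∫ t, ‖ContinuousMap.toLp (E := ℂ) 2 volume ℂ G t‖ ^ 2 = ∫ t, ‖G t‖ ^ 2 := by
    refine integral_congr_ae ?_
    filter_upwards [ContinuousMap.coeFn_toLp (p := 2) (𝕜 := ℂ) volume G] with t ht
    rw [ht]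
  rw [h2, integral_unitAddTorus]
  refine integral_congr_ae (Eventually.of_forall fun x => ?_)
  simp only
  rw [hG x]

/-- Pointwise Fourier inversion. -/
theorem hasSum_torusCoeff {g : EuclideanSpace ℝ (Fin n) → ℂ} (hg : Continuous g)
    (hper : IsPeriodic g) (hs : Summable (torusCoeff g)) (x : EuclideanSpace ℝ (Fin n)) :
    HasSum (fun k => torusCoeff g k * fourierMode k x) (g x) := by
  obtain ⟨G, hG⟩ := exists_torus_lift hg hper
  have h1 : UnitAddTorus.mFourierCoeff G = torusCoeff g :=
    funext (mFourierCoeff_eq_torusCoeff hG)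
  have h2 := UnitAddTorus.hasSum_mFourier_series_apply_of_summable (f := G) (by rwa [h1])
    (fun i => (x i : UnitAddCircle))
  simpa only [h1, smul_eq_mul, ← fourierMode_eq_mFourier, hG x] using h2

/-- Trigonometric polynomials are uniformly dense. -/
theorem exists_trig_polynomial {g : EuclideanSpace ℝ (Fin n) → ℂ} (hg : Continuous g)
    (hper : IsPeriodic g) {δ : ℝ} (hδ : 0 < δ) :
    ∃ (s : Finset (Fin n → ℤ)) (a : (Fin n → ℤ) → ℂ),
      ∀ x, ‖g x - ∑ k ∈ s, a k * fourierMode k x‖ ≤ δ := by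
  obtain ⟨G, hG⟩ := exists_torus_lift hg hper
  have h1 : G ∈ (Submodule.span ℂ (Set.range
      (UnitAddTorus.mFourier (d := Fin n)))).topologicalClosure := by
    rw [UnitAddTorus.span_mFourier_closure_eq_top]
    trivial
  obtain ⟨P, hP, hGP⟩ := Metric.mem_closure_iff.1 h1 δ hδ
  obtain ⟨a, rfl⟩ := Finsupp.mem_span_range_iff_exists_finsupp.1 hP
  refine ⟨a.support, a, fun x => ?_⟩
  have h2 := (ContinuousMap.dist_apply_le_dist (fun i => (x i : UnitAddCircle))).trans hGP.le
  rw [dist_eq_norm, hG x] at h2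
  simpa [Finsupp.sum, ← fourierMode_eq_mFourier] using h2

end TorusBridge

/-! ### Trigonometric series and the approximate cohomological equation -/

section TrigSeries

/-- The real part of the Fourier series with coefficients `c`. -/
def trigSeries (c : (Fin n → ℤ) → ℂ) (x : EuclideanSpace ℝ (Fin n)) : ℝ :=
  ∑' k, (c k * fourierMode k x).re

theorem isPeriodic_trigSeries (c : (Fin n → ℤ) → ℂ) : IsPeriodic (trigSeries c) := fun x m => by
  simp only [trigSeries, isPeriodic_fourierMode _ x m]

theorem hasFDerivAt_re_mul_fourierMode (a : ℂ) (k : Fin n → ℤ) (x : EuclideanSpace ℝ (Fin n)) :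
    HasFDerivAt (fun x => (a * fourierMode k x).re)
      ((a * (2 * Real.pi * Complex.I) * fourierMode k x).re • innerSL ℝ (intVec k)) x := by
  have h := Complex.reCLM.hasFDerivAt.comp x ((hasFDerivAt_fourierMode k x).const_mul a)
  refine h.congr_fderiv ?_
  ext y
  simp [Complex.mul_re, Complex.mul_im]
  ring

variable {c : (Fin n → ℤ) → ℂ}

theorem norm_fderiv_term_le (k : Fin n → ℤ) (x : EuclideanSpace ℝ (Fin n)) :
    ‖(c k * (2 * Real.pi * Complex.I) * fourierMode k x).re • innerSL ℝ (intVec k)‖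
      ≤ 2 * Real.pi * (‖intVec k‖ * ‖c k‖) := by
  rw [norm_smul, innerSL_apply_norm]
  have h : ‖(c k * (2 * Real.pi * Complex.I) * fourierMode k x).re‖ ≤ ‖c k‖ * (2 * Real.pi) := by
    refine (Complex.abs_re_le_norm _).trans ?_
    rw [norm_mul, norm_mul, norm_fourierMode]
    simp [abs_of_pos Real.pi_pos]
  calc _ ≤ ‖c k‖ * (2 * Real.pi) * ‖intVec k‖ := by gcongr
    _ = _ := by ring

theorem summable_re_mul_fourierMode (h0 : Summable fun k => ‖c k‖)
    (x : EuclideanSpace ℝ (Fin n)) : Summable fun k => (c k * fourierMode k x).re := by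
  refine Summable.of_norm_bounded h0 fun k => ?_
  refine (Complex.abs_re_le_norm _).trans ?_
  rw [norm_mul, norm_fourierMode, mul_one]

theorem hasFDerivAt_trigSeries (h0 : Summable fun k => ‖c k‖)
    (h1 : Summable fun k => ‖intVec k‖ * ‖c k‖) (x : EuclideanSpace ℝ (Fin n)) :
    HasFDerivAt (trigSeries c) (∑' k, (c k * (2 * Real.pi * Complex.I) * fourierMode k x).re •
      innerSL ℝ (intVec k)) x :=
  hasFDerivAt_tsum (h1.mul_left (2 * Real.pi))
    (fun k x => hasFDerivAt_re_mul_fourierMode (c k) k x) (fun k x => norm_fderiv_term_le k x)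
    (summable_re_mul_fourierMode h0 0) x

theorem contDiff_trigSeries (h0 : Summable fun k => ‖c k‖)
    (h1 : Summable fun k => ‖intVec k‖ * ‖c k‖) : ContDiff ℝ 1 (trigSeries c) := by
  rw [contDiff_one_iff_fderiv]
  refine ⟨fun x => (hasFDerivAt_trigSeries h0 h1 x).differentiableAt, ?_⟩
  have : fderiv ℝ (trigSeries c) = fun x => ∑' k,
      (c k * (2 * Real.pi * Complex.I) * fourierMode k x).re • innerSL ℝ (intVec k) :=
    funext fun x => (hasFDerivAt_trigSeries h0 h1 x).fderiv
  rw [this]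
  refine continuous_tsum (fun k => ?_) (h1.mul_left (2 * Real.pi))
    (fun k x => norm_fderiv_term_le k x)
  have := continuous_fourierMode k
  fun_prop

theorem hasSum_inner_gradient_trigSeries (h0 : Summable fun k => ‖c k‖)
    (h1 : Summable fun k => ‖intVec k‖ * ‖c k‖) (p x : EuclideanSpace ℝ (Fin n)) :
    HasSum (fun k => (c k * (2 * Real.pi * Complex.I) * fourierMode k x).re *
      inner ℝ p (intVec k)) (inner ℝ p (gradient (trigSeries c) x)) := by
  rw [real_inner_comm, inner_gradient_eq_fderiv, (hasFDerivAt_trigSeries h0 h1 x).fderiv]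
  have hs : Summable fun k => (c k * (2 * Real.pi * Complex.I) * fourierMode k x).re •
      innerSL ℝ (intVec k) :=
    Summable.of_norm_bounded (h1.mul_left (2 * Real.pi)) fun k => norm_fderiv_term_le k x
  have := hs.hasSum.mapL (ContinuousLinearMap.apply ℝ ℝ p)
  simpa [real_inner_comm p] using this

/-- Here `a` is a Fourier coefficient, `e` the value of the character and `t = p · k`. The
coefficient of the solution is chosen to cancel the factor `4πi t`; division by zero being `0`, a
mode with `t = 0` simply drops out. -/
theorem two_mul_re_solve (a e : ℂ) (t : ℝ) :
    2 * ((-a / (4 * Real.pi * Complex.I * t) * (2 * Real.pi * Complex.I) * e).re * t)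
      = if t = 0 then 0 else -(a * e).re := by
  split_ifs with h
  · simp [h]
  · have h1 : (Real.pi : ℂ) ≠ 0 := by exact_mod_cast Real.pi_ne_zero
    have h2 : (t : ℂ) ≠ 0 := by exact_mod_cast h
    have h3 : -a / (4 * Real.pi * Complex.I * t) * (2 * Real.pi * Complex.I) * e
        = (-(1 / (2 * t)) : ℝ) * (a * e) := by
      have := Complex.I_ne_zero
      push_cast
      field_simp
      norm_num
    rw [h3, Complex.re_ofReal_mul]
    field_simp

/-- The cohomological equation `2 p · ∇w = m - g`, with `m` the mean of `g`, is solvable up to an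
arbitrarily small error. -/
theorem exists_approx_cohomological {p : EuclideanSpace ℝ (Fin n)}
    (hp : ∀ k : Fin n → ℤ, k ≠ 0 → inner ℝ p (intVec k) ≠ 0)
    {g : EuclideanSpace ℝ (Fin n) → ℝ} (hg : Continuous g) (hper : IsPeriodic g) {δ : ℝ}
    (hδ : 0 < δ) :
    ∃ w : EuclideanSpace ℝ (Fin n) → ℝ, ContDiff ℝ 1 w ∧ IsPeriodic w ∧
      ∀ x, |2 * inner ℝ p (gradient w x) + g x - ∫ y in unitCube n, g y| ≤ δ := by
  -- Only finitely many denominators occur for a trigonometric polynomial, so nonvanishing of `p ·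
  -- k` suffices and `g` need only be continuous. Half of `δ` pays for the approximation, half for
  -- the change of mean.
  obtain ⟨s, a, ha⟩ := exists_trig_polynomial (g := fun x => (g x : ℂ))
    (Complex.continuous_ofReal.comp hg) (fun x k => by simp only [hper x k]) (half_pos hδ)
  classical
  obtain ⟨c, hc⟩ : ∃ c : (Fin n → ℤ) → ℂ, c = fun k =>
      if k ∈ s then -a k / (4 * Real.pi * Complex.I * (inner ℝ p (intVec k) : ℝ)) else 0 := ⟨_, rfl⟩
  have hc0 : ∀ k ∉ s, c k = 0 := fun k hk => by rw [hc]; exact if_neg hk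
  have h0 : Summable fun k => ‖c k‖ :=
    summable_of_ne_finset_zero (s := s) fun k hk => by rw [hc0 k hk, norm_zero]
  have h1 : Summable fun k => ‖intVec k‖ * ‖c k‖ :=
    summable_of_ne_finset_zero (s := s) fun k hk => by rw [hc0 k hk, norm_zero, mul_zero]
  have hP : ∀ x, |g x - ∑ k ∈ s, (a k * fourierMode k x).re| ≤ δ / 2 := fun x => by
    have := (Complex.abs_re_le_norm _).trans (ha x)
    simpa using this
  have htc : ∀ k, Continuous fun x => (a k * fourierMode k x).re := fun k =>
    Complex.continuous_re.comp (continuous_const.mul (continuous_fourierMode k))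
  have hPc : Continuous fun x => ∑ k ∈ s, (a k * fourierMode k x).re :=
    continuous_finsetSum _ fun k _ => htc k
  have hmean : ∫ x in unitCube n, ∑ k ∈ s, (a k * fourierMode k x).re
      = ∑ k ∈ s, if k = 0 then (a k).re else 0 := by
    rw [integral_finsetSum _ fun k _ => integrableOn_unitCube (htc k)]
    refine Finset.sum_congr rfl fun k _ => ?_
    split_ifs with hk
    · simp only [hk, fourierMode_zero, mul_one]
      exact setIntegral_unitCube_const _
    · have h2 : ∫ x in unitCube n, a k * fourierMode k x = 0 := by
        rw [integral_const_mul, setIntegral_fourierMode_of_ne_zero hk, mul_zero]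
      have h3 := integral_re (𝕜 := ℂ) (f := fun x => a k * fourierMode k x) (integrableOn_unitCube
        (continuous_const.mul (continuous_fourierMode k)))
      rw [h2] at h3
      simpa using h3
  have hm : |(∫ x in unitCube n, g x) - ∑ k ∈ s, if k = 0 then (a k).re else 0| ≤ δ / 2 := by
    rw [← hmean, ← integral_sub (integrableOn_unitCube hg) (integrableOn_unitCube hPc)]
    exact norm_setIntegral_unitCube_le (hg.sub hPc) hP
  refine ⟨trigSeries c, contDiff_trigSeries h0 h1, isPeriodic_trigSeries c, fun x => ?_⟩
  have hgrad : 2 * inner ℝ p (gradient (trigSeries c) x)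
      = ∑ k ∈ s, if k = 0 then 0 else -(a k * fourierMode k x).re := by
    rw [← (hasSum_inner_gradient_trigSeries h0 h1 p x).tsum_eq,
      tsum_eq_sum (s := s) fun k hk => by simp [hc0 k hk], Finset.mul_sum]
    refine Finset.sum_congr rfl fun k hk => ?_
    rw [hc]
    simp only [hk, if_true]
    rw [two_mul_re_solve]
    by_cases hk0 : k = 0
    · simp [hk0, intVec_zero]
    · rw [if_neg (hp k hk0), if_neg hk0]
  have hsplit : ∑ k ∈ s, (a k * fourierMode k x).re
      = (∑ k ∈ s, if k = 0 then (a k).re else 0)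
        - ∑ k ∈ s, if k = 0 then 0 else -(a k * fourierMode k x).re := by
    rw [← Finset.sum_sub_distrib]
    refine Finset.sum_congr rfl fun k _ => ?_
    split_ifs with hk
    · rw [hk, fourierMode_zero, mul_one, sub_zero]
    · ring
  have h4 := abs_le.1 (hP x)
  have h5 := abs_le.1 hm
  rw [hgrad, abs_le]
  constructor <;> linarith

end TrigSeries

/-! ### First corrector and its Dirichlet energy -/

section Corrector

variable {V : EuclideanSpace ℝ (Fin n) → EuclideanSpace ℝ (Fin n)}
  {p : EuclideanSpace ℝ (Fin n)}

theorem inner_eq_sum (x y : EuclideanSpace ℝ (Fin n)) : inner ℝ x y = ∑ j, y j * x j := by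
  simp [PiLp.inner_apply]

theorem inner_gradient_eq_sum (w : EuclideanSpace ℝ (Fin n) → ℝ)
    (x v : EuclideanSpace ℝ (Fin n)) :
    inner ℝ v (gradient w x) = ∑ j, v j * fderiv ℝ w x (EuclideanSpace.single j 1) := by
  rw [real_inner_comm, inner_eq_sum]
  refine Finset.sum_congr rfl fun j _ => ?_
  rw [← inner_gradient_eq_fderiv, EuclideanSpace.inner_single_right]
  simp

theorem norm_gradient_sq (w : EuclideanSpace ℝ (Fin n) → ℝ) (x : EuclideanSpace ℝ (Fin n)) :
    ‖gradient w x‖ ^ 2 = ∑ j, fderiv ℝ w x (EuclideanSpace.single j 1) ^ 2 := by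
  rw [EuclideanSpace.norm_sq_eq]
  refine Finset.sum_congr rfl fun j _ => ?_
  rw [← inner_gradient_eq_fderiv, EuclideanSpace.inner_single_right]
  simp

theorem continuous_gradient {w : EuclideanSpace ℝ (Fin n) → ℝ} (hw : ContDiff ℝ 1 w) :
    Continuous (gradient w) :=
  (InnerProductSpace.toDual ℝ (EuclideanSpace ℝ (Fin n))).symm.continuous.comp
    (hw.continuous_fderiv one_ne_zero)

theorem IsPeriodic.gradient {w : EuclideanSpace ℝ (Fin n) → ℝ} (hw : IsPeriodic w) :
    IsPeriodic (gradient w) := fun x k => by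
  rw [_root_.gradient, _root_.gradient, hw.fderiv x k]

theorem torusCoeff_inner (hV : Continuous V) (p : EuclideanSpace ℝ (Fin n)) (k : Fin n → ℤ) :
    torusCoeff (fun x => ((inner ℝ (V x) p : ℝ) : ℂ)) k
      = ∑ j, (p j : ℂ) * fourierCoeffVec V k j := by
  have hmode : ∀ x, fourierMode (-k) x
      = Complex.exp (-(2 * Real.pi * Complex.I * (inner ℝ (intVec k) x : ℝ))) := by
    intro x
    rw [fourierMode, intVec_neg, inner_neg_left]
    push_cast
    ring_nf
  have hc : ∀ j, Continuous fun x => (p j : ℂ) * (fourierMode (-k) x * ((V x j : ℝ) : ℂ)) :=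
    fun j => by
      have := continuous_fourierMode (-k)
      fun_prop
  simp only [fourierCoeffVec, ← hmode, ← integral_const_mul]
  rw [← integral_finsetSum _ fun j _ => integrableOn_unitCube (hc j)]
  refine integral_congr_ae (Eventually.of_forall fun x => ?_)
  simp only [inner_eq_sum, Complex.ofReal_sum, Complex.ofReal_mul, Finset.mul_sum]
  refine Finset.sum_congr rfl fun j _ => ?_
  ring

theorem IsFlow.torusCoeff_inner_zero (hV : IsFlow V) (p : EuclideanSpace ℝ (Fin n)) :
    torusCoeff (fun x => ((inner ℝ (V x) p : ℝ) : ℂ)) 0 = 0 := by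
  have h1 : ∫ x in unitCube n, inner ℝ p (V x) = inner ℝ p (∫ x in unitCube n, V x) :=
    integral_inner (integrableOn_unitCube hV.smooth.continuous) p
  rw [hV.mean_eq_zero, inner_zero_right] at h1
  simp only [torusCoeff, neg_zero, fourierMode_zero, one_mul, integral_complex_ofReal]
  simp only [real_inner_comm _ p] at h1 ⊢
  rw [h1, Complex.ofReal_zero]

theorem IsDiophantine.ne_zero (hp : IsDiophantine p) {k : Fin n → ℤ} (hk : k ≠ 0) :
    inner ℝ p (intVec k) ≠ 0 := by
  obtain ⟨c, hc, γ, -, h⟩ := hp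
  have h1 : 0 < ‖intVec k‖ := one_pos.trans_le (one_le_norm_intVec hk)
  have h2 := h k hk
  have : 0 < c / ‖intVec k‖ ^ γ := div_pos hc (Real.rpow_pos_of_pos h1 γ)
  exact abs_pos.1 (this.trans_le h2)

/-- Rounding `γ` up to an integer matches the polynomial weights of the decay estimates. The case `k
= 0` is harmless since `0⁻¹ = 0`. -/
theorem IsDiophantine.exists_inv_le (hp : IsDiophantine p) :
    ∃ (C : ℝ) (N : ℕ), 0 ≤ C ∧ ∀ k : Fin n → ℤ,
      |inner ℝ p (intVec k)|⁻¹ ≤ C * ‖intVec k‖ ^ N := by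
  obtain ⟨c, hc, γ, -, h⟩ := hp
  refine ⟨c⁻¹, ⌈γ⌉₊, by positivity, fun k => ?_⟩
  by_cases hk : k = 0
  · rw [hk, intVec_zero, inner_zero_right, abs_zero, inv_zero]
    positivity
  · have h1 := one_le_norm_intVec hk
    have h0 : 0 < ‖intVec k‖ := one_pos.trans_le h1
    have h2 := h k hk
    have h3 : 0 < c / ‖intVec k‖ ^ γ := div_pos hc (Real.rpow_pos_of_pos h0 γ)
    calc |inner ℝ p (intVec k)|⁻¹ ≤ (c / ‖intVec k‖ ^ γ)⁻¹ := inv_anti₀ h3 h2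
      _ = c⁻¹ * ‖intVec k‖ ^ γ := by rw [inv_div, div_eq_inv_mul]
      _ ≤ c⁻¹ * ‖intVec k‖ ^ ⌈γ⌉₊ := by
        gcongr
        rw [← Real.rpow_natCast]
        exact Real.rpow_le_rpow_of_exponent_le h1 (Nat.le_ceil γ)

/-- The exact solution of the first cohomological equation `2 p · ∇w = -V · p`. -/
theorem exists_cohomological (hV : IsFlow V) (hp : IsDiophantine p) :
    ∃ w : EuclideanSpace ℝ (Fin n) → ℝ, ContDiff ℝ 1 w ∧ IsPeriodic w ∧
      ∀ x, 2 * inner ℝ p (gradient w x) = -inner ℝ (V x) p := by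
  obtain ⟨f, hf⟩ : ∃ f : EuclideanSpace ℝ (Fin n) → ℂ,
      f = fun x => ((inner ℝ (V x) p : ℝ) : ℂ) := ⟨_, rfl⟩
  have hfs : ContDiff ℝ ∞ f := by
    rw [hf]
    exact Complex.ofRealCLM.contDiff.comp (hV.smooth.inner ℝ contDiff_const)
  have hfp : IsPeriodic f := fun x k => by rw [hf]; simp only [hV.periodic x k]
  have hf0 : torusCoeff f 0 = 0 := by rw [hf]; exact hV.torusCoeff_inner_zero p
  obtain ⟨C, N, hC, hN⟩ := hp.exists_inv_le
  obtain ⟨c, hc⟩ : ∃ c : (Fin n → ℤ) → ℂ, c = fun k =>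
      -torusCoeff f k / (4 * Real.pi * Complex.I * (inner ℝ p (intVec k) : ℝ)) := ⟨_, rfl⟩
  have hcb : ∀ k, ‖c k‖ ≤ C * (‖intVec k‖ ^ N * ‖torusCoeff f k‖) := by
    intro k
    have h1 : ‖c k‖ = (4 * Real.pi)⁻¹ * (|inner ℝ p (intVec k)|⁻¹ * ‖torusCoeff f k‖) := by
      rw [hc]
      simp [abs_of_pos Real.pi_pos]
      ring
    have h2 : (4 * Real.pi)⁻¹ ≤ 1 := inv_le_one_of_one_le₀ (by linarith [Real.two_le_pi])
    calc ‖c k‖ ≤ 1 * (|inner ℝ p (intVec k)|⁻¹ * ‖torusCoeff f k‖) := by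
          rw [h1]
          gcongr
      _ ≤ C * ‖intVec k‖ ^ N * ‖torusCoeff f k‖ := by
          rw [one_mul]
          gcongr
          exact hN k
      _ = _ := by ring
  have h0 : Summable fun k => ‖c k‖ :=
    Summable.of_nonneg_of_le (fun _ => norm_nonneg _) hcb
      ((summable_norm_pow_mul_norm_torusCoeff hfs hfp N).mul_left C)
  have h1 : Summable fun k => ‖intVec k‖ * ‖c k‖ := by
    refine Summable.of_nonneg_of_le (fun _ => by positivity) (fun k => ?_)
      ((summable_norm_pow_mul_norm_torusCoeff hfs hfp (N + 1)).mul_left C)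
    calc ‖intVec k‖ * ‖c k‖ ≤ ‖intVec k‖ * (C * (‖intVec k‖ ^ N * ‖torusCoeff f k‖)) := by
          gcongr
          exact hcb k
      _ = _ := by ring
  refine ⟨trigSeries c, contDiff_trigSeries h0 h1, isPeriodic_trigSeries c, fun x => ?_⟩
  have hs : Summable (torusCoeff f) := by
    have := summable_norm_pow_mul_norm_torusCoeff hfs hfp 0
    simp only [pow_zero, one_mul] at this
    exact this.of_norm
  have h2 := (hasSum_inner_gradient_trigSeries h0 h1 p x).mul_left 2
  have h3 := (Complex.hasSum_re (hasSum_torusCoeff hfs.continuous hfp hs x)).neg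
  have h4 : ∀ k, 2 * ((c k * (2 * Real.pi * Complex.I) * fourierMode k x).re *
      inner ℝ p (intVec k)) = -(torusCoeff f k * fourierMode k x).re := by
    intro k
    rw [hc, two_mul_re_solve]
    split_ifs with h
    -- The only resonant mode is `k = 0`, where the right-hand side vanishes because the flow has
    -- mean zero.
    · have : k = 0 := by
        by_contra hk
        exact hp.ne_zero hk h
      rw [this, hf0]
      simp
    · rfl
  simp only [h4] at h2
  rw [h2.unique h3, hf, Complex.ofReal_re]

/-- Taking coefficients in the equation itself gives `4πi (p · k) ŵ(k) = -p · v_k`, whatever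
solution `w` is given; the `1 / 4` is the square of the remaining `1 / 2`. -/
theorem torusCoeff_fderiv_cohomological (hV : Continuous V) (hp : IsDiophantine p)
    {w : EuclideanSpace ℝ (Fin n) → ℝ} (hw : ContDiff ℝ 1 w) (hper : IsPeriodic w)
    (hpw : ∀ x, 2 * inner ℝ p (gradient w x) = -inner ℝ (V x) p) (k : Fin n → ℤ) (j : Fin n) :
    ‖torusCoeff (fun x => ((fderiv ℝ w x (EuclideanSpace.single j 1) : ℝ) : ℂ)) k‖ ^ 2
      = 1 / 4 * (‖∑ j, (p j : ℂ) * fourierCoeffVec V k j‖ ^ 2 * (k j : ℝ) ^ 2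
        / |inner ℝ p (intVec k)| ^ 2) := by
  obtain ⟨W, hW⟩ : ∃ W : EuclideanSpace ℝ (Fin n) → ℂ, W = fun x => ((w x : ℝ) : ℂ) := ⟨_, rfl⟩
  have hWc : ContDiff ℝ 1 W := by rw [hW]; exact Complex.ofRealCLM.contDiff.comp hw
  have hWp : IsPeriodic W := fun x k => by rw [hW]; simp only [hper x k]
  have hWd : ∀ x v, fderiv ℝ W x v = ((fderiv ℝ w x v : ℝ) : ℂ) := by
    intro x v
    have : HasFDerivAt W (Complex.ofRealCLM.comp (fderiv ℝ w x)) x := by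
      rw [hW]
      exact Complex.ofRealCLM.hasFDerivAt.comp x (hw.differentiable one_ne_zero x).hasFDerivAt
    rw [this.fderiv]
    rfl
  have hcoef : ∀ j, torusCoeff (fun x => ((fderiv ℝ w x (EuclideanSpace.single j 1) : ℝ) : ℂ)) k
      = 2 * Real.pi * Complex.I * k j * torusCoeff W k := fun j => by
    rw [← torusCoeff_fderiv hWc hWp k j]
    simp only [hWd]
  rw [hcoef]
  by_cases hk : k = 0
  · simp [hk]
  have hpk := hp.ne_zero hk
  have hdir : 2 * ∑ j, (p j : ℂ) * (2 * Real.pi * Complex.I * k j * torusCoeff W k)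
      = -∑ j, (p j : ℂ) * fourierCoeffVec V k j := by
    rw [← torusCoeff_inner hV]
    simp only [← hcoef]
    simp only [torusCoeff, ← integral_const_mul, ← integral_neg]
    rw [← integral_finsetSum]
    · rw [← integral_const_mul]
      refine integral_congr_ae (Eventually.of_forall fun x => ?_)
      have h := hpw x
      rw [inner_gradient_eq_sum] at h
      have h' : (2 : ℂ) * ∑ j, (p j : ℂ) * ((fderiv ℝ w x (EuclideanSpace.single j 1) : ℝ) : ℂ)
          = -((inner ℝ (V x) p : ℝ) : ℂ) := by exact_mod_cast h
      simp only
      rw [← mul_neg, ← h', Finset.mul_sum, Finset.mul_sum, Finset.mul_sum]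
      refine Finset.sum_congr rfl fun j _ => ?_
      ring
    · intro j _
      refine integrableOn_unitCube ?_
      have := continuous_fourierMode (-k)
      have := hw.continuous_fderiv one_ne_zero
      fun_prop
  have hsum : ∑ j, (p j : ℂ) * (2 * Real.pi * Complex.I * k j * torusCoeff W k)
      = 2 * Real.pi * Complex.I * (inner ℝ p (intVec k) : ℝ) * torusCoeff W k := by
    rw [real_inner_comm, inner_eq_sum, Complex.ofReal_sum, Finset.mul_sum, Finset.sum_mul]
    refine Finset.sum_congr rfl fun j _ => ?_
    simp [intVec]
    ring
  rw [hsum] at hdir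
  have hn := congrArg norm hdir
  rw [norm_neg] at hn
  rw [← hn]
  have hpos : 0 < |inner ℝ p (intVec k)| := abs_pos.2 hpk
  simp only [norm_mul, Complex.norm_real, Real.norm_eq_abs, Complex.norm_I, Complex.norm_intCast,
    Complex.norm_ofNat, abs_of_pos Real.pi_pos, mul_pow]
  rw [sq_abs (k j : ℝ)]
  field_simp
  ring

/-- Parseval for each partial derivative; summing over `j` turns `k_j ^ 2` into `‖intVec k‖ ^ 2`. -/
theorem hasSum_secondOrderTerm (hV : Continuous V) (hp : IsDiophantine p)
    {w : EuclideanSpace ℝ (Fin n) → ℝ} (hw : ContDiff ℝ 1 w) (hper : IsPeriodic w)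
    (hpw : ∀ x, 2 * inner ℝ p (gradient w x) = -inner ℝ (V x) p) :
    HasSum (fun k : {k : Fin n → ℤ // k ≠ 0} => 1 / 4 * secondOrderTerm V p k)
      (∫ x in unitCube n, ‖gradient w x‖ ^ 2) := by
  have hc : ∀ j, Continuous fun x => fderiv ℝ w x (EuclideanSpace.single j 1) := fun j => by
    have := hw.continuous_fderiv one_ne_zero
    fun_prop
  have h1 : HasSum (fun k => ∑ j, 1 / 4 * (‖∑ j, (p j : ℂ) * fourierCoeffVec V k j‖ ^ 2
      * (k j : ℝ) ^ 2 / |inner ℝ p (intVec k)| ^ 2))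
      (∑ j, ∫ x in unitCube n, fderiv ℝ w x (EuclideanSpace.single j 1) ^ 2) := by
    refine hasSum_sum fun j _ => ?_
    have := hasSum_sq_torusCoeff
      (g := fun x => ((fderiv ℝ w x (EuclideanSpace.single j 1) : ℝ) : ℂ))
      (Complex.continuous_ofReal.comp (hc j)) (fun x k => by simp only [hper.fderiv x k])
    simpa only [torusCoeff_fderiv_cohomological hV hp hw hper hpw, Complex.norm_real,
      Real.norm_eq_abs, sq_abs] using this
  have hc2 : ∀ j, Continuous fun x => fderiv ℝ w x (EuclideanSpace.single j 1) ^ 2 := fun j =>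
    (hc j).pow 2
  rw [← integral_finsetSum _ fun j _ => integrableOn_unitCube (hc2 j)] at h1
  simp only [← norm_gradient_sq] at h1
  have h2 : ∀ k : Fin n → ℤ, ∑ j, 1 / 4 * (‖∑ j, (p j : ℂ) * fourierCoeffVec V k j‖ ^ 2
      * (k j : ℝ) ^ 2 / |inner ℝ p (intVec k)| ^ 2) = 1 / 4 * secondOrderTerm V p k := by
    intro k
    rw [← Finset.mul_sum, ← Finset.sum_div, ← Finset.mul_sum, secondOrderTerm,
      EuclideanSpace.norm_sq_eq (intVec k)]
    simp [intVec]
  simp only [h2] at h1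
  refine (hasSum_subtype_iff_of_support_subset (s := {k : Fin n → ℤ | k ≠ 0}) ?_).2 h1
  intro k hk hk0
  apply hk
  subst hk0
  simp [secondOrderTerm, intVec_zero]

/-- Incompressibility makes the integrand the divergence of `w V`. -/
theorem IsFlow.integral_inner_gradient (hV : IsFlow V) {w : EuclideanSpace ℝ (Fin n) → ℝ}
    (hw : ContDiff ℝ 1 w) (hper : IsPeriodic w) :
    ∫ x in unitCube n, inner ℝ (V x) (gradient w x) = 0 := by
  have hV1 : ContDiff ℝ 1 V := hV.smooth.of_le (by exact_mod_cast le_top)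
  have hVi : ∀ i, ContDiff ℝ 1 fun x => V x i := fun i => contDiff_euclidean.1 hV1 i
  rw [← setIntegral_divergence_eq_zero (fun i x => w x * V x i) (fun i => hw.mul (hVi i))
    (fun i x k => by simp only [hper x k, hV.periodic x k])]
  refine integral_congr_ae (Eventually.of_forall fun x => ?_)
  simp only
  rw [inner_gradient_eq_sum]
  have h1 : ∀ i, fderiv ℝ (fun x => w x * V x i) x (EuclideanSpace.single i 1)
      = V x i * fderiv ℝ w x (EuclideanSpace.single i 1)
        + w x * (fderiv ℝ V x (EuclideanSpace.single i 1)) i := by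
    intro i
    have h2 : HasFDerivAt (fun x => V x i) ((EuclideanSpace.proj i).comp (fderiv ℝ V x)) x :=
      (EuclideanSpace.proj (𝕜 := ℝ) i).hasFDerivAt.comp x
        (hV1.differentiable one_ne_zero x).hasFDerivAt
    have h3 : HasFDerivAt (fun x => w x * V x i) _ x :=
      (hw.differentiable one_ne_zero x).hasFDerivAt.mul h2
    rw [h3.fderiv]
    simp
    ring
  simp only [h1, Finset.sum_add_distrib, ← Finset.mul_sum, hV.div_eq_zero x]
  simp

end Corrector

/-! ### Second-order expansion of the effective Hamiltonian -/

section Expansion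

variable {V : EuclideanSpace ℝ (Fin n) → EuclideanSpace ℝ (Fin n)}
  {p : EuclideanSpace ℝ (Fin n)}

theorem IsFlow.contDiff_smul (hV : IsFlow V) (ε : ℝ) : ContDiff ℝ 1 fun x => ε • V x := by
  have h : ContDiff ℝ 1 V := hV.smooth.of_le (by exact_mod_cast le_top)
  exact h.const_smul ε

theorem IsFlow.isPeriodic_smul (hV : IsFlow V) (ε : ℝ) : IsPeriodic fun x => ε • V x :=
  fun x k => by simp only [hV.periodic x k]

theorem IsFlow.isErgodicConstant (hV : IsFlow V) (ε : ℝ) (q : EuclideanSpace ℝ (Fin n)) :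
    IsErgodicConstant (fun x => ε • V x) q (effectiveHamiltonian (fun x => ε • V x) q) :=
  isErgodicConstant_effectiveHamiltonian (hV.isPeriodic_smul ε) (hV.contDiff_smul ε) q

theorem gradient_const_mul_add {f g : EuclideanSpace ℝ (Fin n) → ℝ} (hf : ContDiff ℝ 1 f)
    (hg : ContDiff ℝ 1 g) (a b : ℝ) (x : EuclideanSpace ℝ (Fin n)) :
    gradient (fun y => a * f y + b * g y) x = a • gradient f x + b • gradient g x := by
  have h1 := ((hf.differentiable one_ne_zero x).hasFDerivAt.const_mul a).add
    ((hg.differentiable one_ne_zero x).hasFDerivAt.const_mul b)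
  have h2 : fderiv ℝ (fun y => a * f y + b * g y) x = a • fderiv ℝ f x + b • fderiv ℝ g x :=
    h1.fderiv
  rw [gradient, h2, map_add, gradient, gradient]
  congr 1 <;> exact LinearIsometryEquiv.map_smulₛₗ _ _ _

theorem hamiltonian_corrected (v D₁ D₂ : EuclideanSpace ℝ (Fin n)) {ε l s : ℝ}
    (hs : l * s = ε ^ 2) (h : 2 * inner ℝ p D₁ = -inner ℝ v p) :
    ‖l • p + (ε • D₁ + s • D₂)‖ ^ 2 + inner ℝ (ε • v) (l • p + (ε • D₁ + s • D₂))
      = l ^ 2 * ‖p‖ ^ 2 + ε ^ 2 * (2 * inner ℝ p D₂ + (‖D₁‖ ^ 2 + inner ℝ v D₁))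
        + s * (ε * (2 * inner ℝ D₁ D₂ + inner ℝ v D₂) + s * ‖D₂‖ ^ 2) := by
  simp only [norm_add_sq_real, inner_add_right, inner_smul_left, inner_smul_right,
    norm_smul, mul_pow, Real.norm_eq_abs, sq_abs, conj_trivial]
  linear_combination (ε * l) * h + 2 * inner ℝ p D₂ * hs

/-- The first corrector does not depend on `l`, because `2 l p · Dw₁` and `V · (l p)` scale alike;
the second carries `s = ε² / l`. As `s ≤ ε² / l₀`, the remainder is `O(|ε|³)` uniformly in `l ≥ l₀`.
-/
theorem abs_effectiveHamiltonian_sub_le (hV : IsFlow V) (hp : IsDiophantine p) {a : ℝ}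
    {w₁ : EuclideanSpace ℝ (Fin n) → ℝ} (hw₁ : ContDiff ℝ 1 w₁) (hper₁ : IsPeriodic w₁)
    (hpw : ∀ x, 2 * inner ℝ p (gradient w₁ x) = -inner ℝ (V x) p)
    (ha : ∫ x in unitCube n, (‖gradient w₁ x‖ ^ 2 + inner ℝ (V x) (gradient w₁ x)) = a)
    {δ l₀ : ℝ} (hδ : 0 < δ) (hl₀ : 0 < l₀) :
    ∃ ε₀ > 0, ∀ ε : ℝ, |ε| < ε₀ → ∀ l ≥ l₀,
      |effectiveHamiltonian (fun x => ε • V x) (l • p) - l ^ 2 * ‖p‖ ^ 2 - ε ^ 2 * a|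
        ≤ δ * ε ^ 2 := by
  have hVc := hV.smooth.continuous
  have hD₁ := continuous_gradient hw₁
  have hG : Continuous fun x => ‖gradient w₁ x‖ ^ 2 + inner ℝ (V x) (gradient w₁ x) := by
    fun_prop
  obtain ⟨w₂, hw₂, hper₂, happ⟩ := exists_approx_cohomological (fun k hk => hp.ne_zero hk) hG
    (fun x k => by simp only [hper₁.gradient x k, hV.periodic x k]) (half_pos hδ)
  rw [ha] at happ
  obtain ⟨B, hB0, hB⟩ := hV.periodic.exists_norm_le hVc
  obtain ⟨C₁, hC₁0, hC₁⟩ := hper₁.gradient.exists_norm_le hD₁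
  obtain ⟨C₂, hC₂0, hC₂⟩ := hper₂.gradient.exists_norm_le (continuous_gradient hw₂)
  obtain ⟨M, hM⟩ : ∃ M, M = l₀⁻¹ * ((2 * (C₁ * C₂) + B * C₂) + l₀⁻¹ * C₂ ^ 2) := ⟨_, rfl⟩
  have hM0 : 0 ≤ M := by rw [hM]; positivity
  refine ⟨min 1 (δ / 2 / (M + 1)), by positivity, fun ε hε l hl => ?_⟩
  have hε1 : |ε| ≤ 1 := (hε.trans_le (min_le_left _ _)).le
  have hε2 : |ε| * (M + 1) ≤ δ / 2 := by
    have := (hε.trans_le (min_le_right _ _)).le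
    rwa [le_div_iff₀ (by positivity)] at this
  have hl0 : 0 < l := hl₀.trans_le hl
  obtain ⟨s, hs⟩ : ∃ s, s = l⁻¹ * ε ^ 2 := ⟨_, rfl⟩
  have hls : l * s = ε ^ 2 := by rw [hs, mul_inv_cancel_left₀ hl0.ne']
  have hs0 : 0 ≤ s := by rw [hs]; positivity
  have hs1 : s ≤ l₀⁻¹ * ε ^ 2 := by
    rw [hs]
    gcongr
  have hsq : ε ^ 2 ≤ |ε| := by
    rw [← sq_abs]
    nlinarith [abs_nonneg ε]
  have hw : ContDiff ℝ 1 fun y => ε * w₁ y + s * w₂ y :=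
    (contDiff_const.mul hw₁).add (contDiff_const.mul hw₂)
  have hwp : IsPeriodic fun y => ε * w₁ y + s * w₂ y := fun x k => by
    simp only [hper₁ x k, hper₂ x k]
  have hmain : ∀ x, |hamiltonian (fun x => ε • V x)
      (l • p + gradient (fun y => ε * w₁ y + s * w₂ y) x) x - (l ^ 2 * ‖p‖ ^ 2 + ε ^ 2 * a)|
        ≤ δ * ε ^ 2 := by
    intro x
    rw [gradient_const_mul_add hw₁ hw₂, hamiltonian, hamiltonian_corrected _ _ _ hls (hpw x)]
    have h1 := happ x
    have h2 : |2 * inner ℝ (gradient w₁ x) (gradient w₂ x) + inner ℝ (V x) (gradient w₂ x)|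
        ≤ 2 * (C₁ * C₂) + B * C₂ := by
      refine (abs_add_le _ _).trans ?_
      rw [abs_mul, abs_two]
      gcongr
      · exact (abs_real_inner_le_norm _ _).trans
          (mul_le_mul (hC₁ x) (hC₂ x) (norm_nonneg _) hC₁0)
      · exact (abs_real_inner_le_norm _ _).trans
          (mul_le_mul (hB x) (hC₂ x) (norm_nonneg _) hB0)
    have h3 : |s * (ε * (2 * inner ℝ (gradient w₁ x) (gradient w₂ x)
        + inner ℝ (V x) (gradient w₂ x)) + s * ‖gradient w₂ x‖ ^ 2)| ≤ ε ^ 2 * (δ / 2) := by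
      have h4 : s ≤ l₀⁻¹ * |ε| := hs1.trans (by gcongr)
      calc _ ≤ s * (|ε| * (2 * (C₁ * C₂) + B * C₂) + (l₀⁻¹ * |ε|) * C₂ ^ 2) := by
            rw [abs_mul, abs_of_nonneg hs0]
            refine mul_le_mul_of_nonneg_left ((abs_add_le _ _).trans ?_) hs0
            rw [abs_mul, abs_of_nonneg (mul_nonneg hs0 (sq_nonneg ‖gradient w₂ x‖))]
            have := hC₂ x
            gcongr
        _ ≤ (l₀⁻¹ * ε ^ 2) * (|ε| * (2 * (C₁ * C₂) + B * C₂) + (l₀⁻¹ * |ε|) * C₂ ^ 2) := by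
            gcongr
        _ = ε ^ 2 * (|ε| * M) := by rw [hM]; ring
        _ ≤ ε ^ 2 * (δ / 2) := by
            gcongr
            nlinarith [abs_nonneg ε]
    have h5 : |ε ^ 2 * (2 * inner ℝ p (gradient w₂ x) + (‖gradient w₁ x‖ ^ 2
        + inner ℝ (V x) (gradient w₁ x)) - a)| ≤ ε ^ 2 * (δ / 2) := by
      rw [abs_mul, abs_of_nonneg (sq_nonneg ε)]
      gcongr
    rw [abs_le] at h3 h5 ⊢
    constructor <;> linarith
  have hc := hV.isErgodicConstant ε (l • p)
  have hup := hc.le_of_forall_hamiltonian_le hwp hw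
    (a := l ^ 2 * ‖p‖ ^ 2 + ε ^ 2 * a + δ * ε ^ 2) fun x => by
      linarith [(abs_le.1 (hmain x)).2]
  have hlo := hc.le_of_forall_le_hamiltonian hwp hw
    (a := l ^ 2 * ‖p‖ ^ 2 + ε ^ 2 * a - δ * ε ^ 2) fun x => by
      linarith [(abs_le.1 (hmain x)).1]
  rw [abs_le]
  constructor <;> linarith

/-- Zero corrector and completion of the square. Valid for every `q`, it covers the small `l` that
the expansion does not reach. -/
theorem IsFlow.le_effectiveHamiltonian (hV : IsFlow V) {B : ℝ} (hB : ∀ x, ‖V x‖ ≤ B) (ε : ℝ)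
    (q : EuclideanSpace ℝ (Fin n)) :
    -(ε ^ 2 * (B ^ 2 / 4)) ≤ effectiveHamiltonian (fun x => ε • V x) q := by
  refine (hV.isErgodicConstant ε q).le_of_forall_le_hamiltonian (w := fun _ => 0)
    (fun _ _ => rfl) contDiff_const fun x => ?_
  have h0 : gradient (fun _ : EuclideanSpace ℝ (Fin n) => (0 : ℝ)) x = 0 := by
    simp [gradient]
  rw [h0, add_zero, hamiltonian]
  have h1 := (abs_le.1 (abs_real_inner_le_norm (ε • V x) q)).1
  have h2 : ‖ε • V x‖ * ‖q‖ ≤ |ε| * B * ‖q‖ := by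
    rw [norm_smul, Real.norm_eq_abs]
    gcongr
    exact hB x
  nlinarith [sq_nonneg (‖q‖ - |ε| * B / 2), sq_abs ε]

end Expansion

/-! ### Minimisation over `l` -/

section Burning

/-- The minimum over `l` is `2 P √(1 + t)`, and `√(1 + t) ≥ m` with `m = 1 + t / 2 - t ^ 2 / 2`.
Indeed `(m - l P) ^ 2 ≥ 0` and `1 + t - m ^ 2 = t ^ 2 (1 + t) (3 - t) / 4 ≥ 0`. -/
theorem two_mul_add_le_div {P l t : ℝ} (hl : 0 < l) (ht : |t| ≤ 1) :
    2 * P + P * t - P * t ^ 2 ≤ (1 + t + l ^ 2 * P ^ 2) / l := by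
  rw [le_div_iff₀ hl]
  have h := abs_le.1 ht
  nlinarith [sq_nonneg (1 - l * P + t * (1 - t) / 2), mul_nonneg (sq_nonneg t)
    (show 0 ≤ (1 + t) * (3 - t) by nlinarith)]

theorem eventually_sq_mul_le (K : ℝ) {r : ℝ} (hr : 0 < r) :
    ∀ᶠ ε : ℝ in 𝓝[≠] 0, ε ^ 2 * K ≤ r := by
  have h : Tendsto (fun ε : ℝ => ε ^ 2 * K) (𝓝 0) (𝓝 (0 ^ 2 * K)) :=
    (tendsto_id.pow 2).mul_const K
  rw [zero_pow two_ne_zero, zero_mul] at h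
  exact ((h.mono_left nhdsWithin_le_nhds).eventually (gt_mem_nhds hr)).mono fun _ => le_of_lt

/-- The second-order asymptotics of the infimum of `(1 + h ε l) / l` for a family `h` with a
uniform second-order expansion away from `l = 0`. -/
theorem tendsto_iInf_div {P a B : ℝ} (hP : 0 < P) {h : ℝ → ℝ → ℝ}
    (hlow : ∀ ε l, -(ε ^ 2 * B) ≤ h ε l)
    (hexp : ∀ δ > 0, ∀ l₀ > 0, ∃ ε₀ > 0, ∀ ε : ℝ, |ε| < ε₀ → ∀ l ≥ l₀,
      |h ε l - l ^ 2 * P ^ 2 - ε ^ 2 * a| ≤ δ * ε ^ 2) :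
    Tendsto (fun ε : ℝ => ((⨅ l : Set.Ioi (0 : ℝ), (1 + h ε l) / (l : ℝ)) - 2 * P) / (ε ^ 2 * P))
      (𝓝[≠] 0) (𝓝 a) := by
  rw [Metric.tendsto_nhds]
  intro η hη
  obtain ⟨δ, hδ⟩ : ∃ δ, δ = η / 3 := ⟨_, rfl⟩
  have hδ0 : 0 < δ := by rw [hδ]; positivity
  -- Below `1 / (6 P)` the bound `1 + h ε l ≥ 1 / 2` already makes the quotient at least `3 P`, so
  -- the expansion is needed only above this threshold.
  obtain ⟨ε₀, hε₀, hε⟩ := hexp δ hδ0 (1 / (6 * P)) (by positivity)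
  have hsmall : ∀ᶠ ε : ℝ in 𝓝[≠] 0, |ε| < ε₀ := by
    have : Metric.ball (0 : ℝ) ε₀ ∈ 𝓝 0 := Metric.ball_mem_nhds _ hε₀
    filter_upwards [mem_nhdsWithin_of_mem_nhds this] with ε h
    simpa using h
  filter_upwards [hsmall, self_mem_nhdsWithin, eventually_sq_mul_le B one_half_pos,
    eventually_sq_mul_le (|a| + δ) one_pos, eventually_sq_mul_le ((a - δ) ^ 2) hδ0]
    with ε h1 hne hB2 ha1 ha2
  have hε2 : 0 < ε ^ 2 := sq_pos_iff.2 hne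
  have hup : (⨅ l : Set.Ioi (0 : ℝ), (1 + h ε l) / (l : ℝ)) ≤ 2 * P + ε ^ 2 * P * (a + δ) := by
    have hbdd : BddBelow (Set.range fun l : Set.Ioi (0 : ℝ) => (1 + h ε l) / (l : ℝ)) := by
      refine ⟨0, ?_⟩
      rintro _ ⟨⟨l, hl⟩, rfl⟩
      have hl : 0 < l := hl
      have := hlow ε l
      exact div_nonneg (by linarith) hl.le
    -- `P⁻¹` is the minimiser of the unperturbed problem.
    have hl : 0 < P⁻¹ := by positivity
    refine (ciInf_le hbdd ⟨P⁻¹, hl⟩).trans ?_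
    have h2 := (abs_le.1 (hε ε h1 P⁻¹ (by
      rw [ge_iff_le, one_div]
      exact inv_anti₀ hP (by linarith)))).2
    have h3 : P⁻¹ ^ 2 * P ^ 2 = 1 := by field_simp
    rw [h3] at h2
    rw [div_le_iff₀ hl]
    have h4 : (2 * P + ε ^ 2 * P * (a + δ)) * P⁻¹ = 2 + ε ^ 2 * (a + δ) := by field_simp
    rw [h4]
    linarith
  -- One `δ` is lost to the expansion, the other to the quadratic term of `two_mul_add_le_div`.
  have hlo : 2 * P + ε ^ 2 * P * (a - 2 * δ)
      ≤ ⨅ l : Set.Ioi (0 : ℝ), (1 + h ε l) / (l : ℝ) := by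
    have : Nonempty (Set.Ioi (0 : ℝ)) := ⟨⟨1, Set.mem_Ioi.2 one_pos⟩⟩
    refine le_ciInf ?_
    rintro ⟨l, hl⟩
    have hl : 0 < l := hl
    simp only
    have hca := le_abs_self a
    have hca' := neg_abs_le a
    rcases lt_or_ge l (1 / (6 * P)) with hl1 | hl1
    · have h2 := hlow ε l
      have h3 : 2 * P + ε ^ 2 * P * (a - 2 * δ) ≤ 3 * P := by
        have : ε ^ 2 * (a - 2 * δ) ≤ ε ^ 2 * (|a| + δ) := by gcongr; linarith
        nlinarith
      refine h3.trans ?_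
      rw [le_div_iff₀ hl]
      rw [lt_div_iff₀ (by positivity)] at hl1
      linarith
    · have h2 := (abs_le.1 (hε ε h1 l hl1)).1
      have ht : |ε ^ 2 * (a - δ)| ≤ 1 := by
        rw [abs_mul, abs_of_pos hε2]
        refine le_trans ?_ ha1
        gcongr
        exact (abs_sub _ _).trans (by rw [abs_of_pos hδ0])
      have h3 := two_mul_add_le_div (P := P) hl ht
      have h4 : (1 + ε ^ 2 * (a - δ) + l ^ 2 * P ^ 2) / l ≤ (1 + h ε l) / l :=
        div_le_div_of_nonneg_right (by linarith) hl.le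
      have h5 : P * (ε ^ 2 * (a - δ)) ^ 2 ≤ P * (ε ^ 2 * δ) := by
        have : (ε ^ 2 * (a - δ)) ^ 2 = ε ^ 2 * (ε ^ 2 * (a - δ) ^ 2) := by ring
        rw [this]
        gcongr
      linarith
  have hpos : 0 < ε ^ 2 * P := by positivity
  rw [Real.dist_eq]
  have h6 : ((⨅ l : Set.Ioi (0 : ℝ), (1 + h ε l) / (l : ℝ)) - 2 * P) / (ε ^ 2 * P) ≤ a + δ := by
    rw [div_le_iff₀ hpos]
    linarith
  have h7 : a - 2 * δ
      ≤ ((⨅ l : Set.Ioi (0 : ℝ), (1 + h ε l) / (l : ℝ)) - 2 * P) / (ε ^ 2 * P) := by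
    rw [le_div_iff₀ hpos]
    linarith
  rw [abs_lt]
  constructor <;> linarith

end Burning

end FlameSpeed

end

/-! ### Conclusion -/

open FlameSpeed in
theorem lemma3p2 {n : ℕ} (V : EuclideanSpace ℝ (Fin n) → EuclideanSpace ℝ (Fin n))
    (hV : FlameSpeed.IsFlow V) (p : EuclideanSpace ℝ (Fin n)) (hp : FlameSpeed.IsDiophantine p) :
    (∀ (ε : ℝ) (q : EuclideanSpace ℝ (Fin n)),
      ∃! c : ℝ, FlameSpeed.IsErgodicConstant (fun x => ε • V x) q c) ∧
    Summable (fun k : {k : Fin n → ℤ // k ≠ 0} => FlameSpeed.secondOrderTerm V p k) ∧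
    Tendsto
      (fun ε : ℝ =>
        (FlameSpeed.burningVelocity (fun x => ε • V x) p - 2 * ‖p‖) / (ε ^ 2 * ‖p‖))
      (𝓝[≠] 0) (𝓝 (FlameSpeed.secondOrderCoeff V p)) := by
  have hVc := hV.smooth.continuous
  obtain ⟨w, hw, hper, hpw⟩ := exists_cohomological hV hp
  have hsum := hasSum_secondOrderTerm hVc hp hw hper hpw
  have hD := continuous_gradient hw
  have hmean : ∫ x in unitCube n, (‖gradient w x‖ ^ 2 + inner ℝ (V x) (gradient w x))
      = secondOrderCoeff V p := by
    have h1 : Continuous fun x => ‖gradient w x‖ ^ 2 := by fun_prop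
    have h2 : Continuous fun x => inner ℝ (V x) (gradient w x) := by fun_prop
    rw [integral_add (integrableOn_unitCube h1) (integrableOn_unitCube h2),
      hV.integral_inner_gradient hw hper, add_zero, ← hsum.tsum_eq, tsum_mul_left,
      secondOrderCoeff]
  refine ⟨fun ε q => existsUnique_isErgodicConstant (hV.isPeriodic_smul ε) (hV.contDiff_smul ε) q,
    (summable_mul_left_iff (by norm_num : (1 / 4 : ℝ) ≠ 0)).1 hsum.summable, ?_⟩
  obtain ⟨B, -, hB⟩ := hV.periodic.exists_norm_le hVc
  rcases (norm_nonneg p).eq_or_lt with hp0 | hp0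
  -- `p = 0` is Diophantine only if there is no nonzero integer vector; then the series is empty and
  -- the quotient is a division by zero, so both sides are `0`.
  · have hk : IsEmpty {k : Fin n → ℤ // k ≠ 0} := by
      refine ⟨fun k => hp.ne_zero k.2 ?_⟩
      rw [norm_eq_zero.1 hp0.symm, inner_zero_left]
    simp [← hp0, secondOrderCoeff]
  · exact tendsto_iInf_div hp0
      (h := fun ε l => effectiveHamiltonian (fun x => ε • V x) (l • p))
      (fun ε l => hV.le_effectiveHamiltonian hB ε (l • p))
      fun δ hδ l₀ hl₀ => abs_effectiveHamiltonian_sub_le hV hp hw hper hpw hmean hδ hl₀
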